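/- Let $\mathcal X=\{1,2,\dots\}$, let $\mathcal Y$ be a finite set (with the discrete $\sigma$-algebra), $L\ge 1$ an integer, $\varepsilon$ a real number and $Q$ a probability distribution on $\mathcal X$ with decreasing rearrangement $Q^{\downarrow}(1)\ge Q^{\downarrow}(2)\ge\cdots$. Assume $$1-\sum_{x=1}^{|\mathcal Y|L}Q^{\downarrow}(x)\ \le\ \varepsilon\ \le\ 1-\sum_{x=1}^{L}Q^{\downarrow}(x).$$ For $j\ge 1$ put $\mathcal V(j)=\dfrac{(1-\varepsilon)-\sum_{x=1}^{j-1}Q^{\downarrow}(x)}{L-j+1}$ if $j\le L$ and $\mathcal V(j)=1$ if $j>L$. For integers $k\ge L$ put $\mathcal W(L)=-1$ and $\mathcal W(k)=\dfrac{\sum_{x=1}^{k}Q^{\downarrow}(x)-(1-\varepsilon)}{k-L}$ if $k>L$. Let $$J=\min\{j\ge 1: Q^{\downarrow}(j)<\mathcal V(j)\},\qquad K_2=\max\{L\le k\le|\mathcal Y|L:\ \mathcal W(k)<Q^{\downarrow}(k)\}.$$ The Fano-distribution of type 2, $P_2=P^{(Q,L,\varepsilon,\mathcal Y)}_{\text{Fano-type2}}$,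 is given by $P_2(x)=Q^{\downarrow}(x)$ if $x<J$ or $x>K_2$, $P_2(x)=\mathcal V(J)$ if $J\le x\le L$, and $P_2(x)=\mathcal W(K_2)$ if $L<x\le K_2$. For a distribution $P$ on $\mathcal X$ and $\alpha\in(0,1)\cup(1,\infty)$ let $\|P\|_\alpha=(\sum_x P(x)^\alpha)^{1/\alpha}$, $H_\alpha(P)=\frac1{1-\alpha}\log\sum_xP(x)^\alpha$, and let $H_1(P)=\sum_x\eta(P(x))$ with $\eta(u)=-u\log u$, $\eta(0)=0$ (values in $[0,\infty]$). For random variables $X,Y$ with values in $\mathcal X,\mathcal Y$, with $P_{X|Y}$ the regular conditional distribution of $X$ given $Y$, let $$H^{\mathrm A}_\alpha(X|Y)=\tfrac{\alpha}{1-\alpha}\log\mathbb E\big[\|P_{X|Y}\|_\alpha\big],\qquad H^{\mathrm H}_\alpha(X|Y)=\tfrac{1}{1-\alpha}\log\mathbb E\big[\|P_{X|Y}\|_\alpha^\alpha\big]$$ be Arimoto's and Hayashi's conditional Rényi entropies, and let $H_1^{\mathrm A}(X|Y)=H_1^{\mathrm H}(X|Y)=H(X|Y)=\mathbb E[H_1(P_{X|Y})]$.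 Let $P_{\mathrm e}^{(L)}(X|Y)=\min_f\mathbb P\{X\notin f(Y)\}$, where $f$ ranges over the maps from $\mathcal Y$ to the subsets of $\mathcal X$ with at least $1$ and at most $L$ elements. Then $P_2$ is a probability distribution on $\mathcal X$, and for every $\dagger\in\{\mathrm A,\mathrm H\}$ and every $\alpha\in(0,\infty)$, $$\sup_{(X,Y):\,P_{\mathrm e}^{(L)}(X|Y)\le\varepsilon,\ P_X=Q}H^{\dagger}_\alpha(X|Y)\ \le\ H_\alpha(P_2),$$ where for $\alpha\ne1$ $$H_\alpha(P_2)=\frac1{1-\alpha}\log\Big((L-J+1)\,\mathcal V(J)^\alpha+(K_2-L)\,\mathcal W(K_2)^\alpha+\sum_{x<J\text{ or }x>K_2}Q^{\downarrow}(x)^\alpha\Big)$$ and for $\alpha=1$ $$H_1(P_2)=(L-J+1)\,\eta(\mathcal V(J))+(K_2-L)\,\eta(\mathcal W(K_2))+\sum_{x<J\text{ or }x>K_2}\eta(Q^{\downarrow}(x)),$$ a term with coefficient $0$ being read as $0$. In particular, for $\alpha=1$ and $L=1$ this gives the refined Ho–Verdú–Fano inequality $$\sup_{(X,Y):\,P_{\mathrm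 e}^{(1)}(X|Y)\le\varepsilon,\ P_X=Q}H(X|Y)\ \le\ \eta(1-\varepsilon)+(K_2-1)\,\eta(\mathcal W(K_2))+\sum_{x>K_2}\eta(Q^{\downarrow}(x)).$$ -/

import Mathlib

open MeasureTheory ProbabilityTheory
open scoped ENNReal

universe u v

noncomputable section

namespace FanoRenyi

/-- The alphabet `{1, 2, …}` carries the discrete σ-algebra. -/
instance instMeasurableSpacePNat : MeasurableSpace ℕ+ := ⊤

instance instDiscreteMeasurableSpacePNat : DiscreteMeasurableSpace ℕ+ := ⟨fun _ => trivial⟩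

/-! ### Decreasing rearrangement and the Fano-distribution of type 2 -/

/-- The decreasing rearrangement of `Q`: for `i ≥ 1` this is the `i`-th largest of the masses of `Q`
(with multiplicity), i.e. the least `t ≥ 0` such that fewer than `i` symbols have mass `> t`. -/
def decr (Q : PMF ℕ+) (i : ℕ) : ℝ :=
  sInf {t : ℝ | 0 ≤ t ∧ {x : ℕ+ | t < (Q x).toReal}.encard < (i : ℕ∞)}

/-- The partial sum of the `k` largest masses of `Q`. -/
def topSum (Q : PMF ℕ+) (k : ℕ) : ℝ := ∑ i ∈ Finset.Icc 1 k, decr Q i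

/-- The standing assumption on the system `(Q, L, ε, 𝒴)`, where `m` is the cardinality of `𝒴`. -/
def Admissible (Q : PMF ℕ+) (L : ℕ) (ε : ℝ) (m : ℕ) : Prop :=
  1 - topSum Q (m * L) ≤ ε ∧ ε ≤ 1 - topSum Q L

/-- The weight `𝒱(j)`, `j ≥ 1`. -/
def V (Q : PMF ℕ+) (L : ℕ) (ε : ℝ) (j : ℕ) : ℝ :=
  if j ≤ L then ((1 - ε) - topSum Q (j - 1)) / ((L : ℝ) - (j : ℝ) + 1) else 1

/-- The weight `𝒲(k)`, `L ≤ k < ∞`. -/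
def W (Q : PMF ℕ+) (L : ℕ) (ε : ℝ) (k : ℕ) : ℝ :=
  if k = L then -1 else (topSum Q k - (1 - ε)) / ((k : ℝ) - (L : ℝ))

/-- `J = min {j ≥ 1 | Q↓(j) < 𝒱(j)}`. -/
def J (Q : PMF ℕ+) (L : ℕ) (ε : ℝ) : ℕ :=
  sInf {j : ℕ | 1 ≤ j ∧ decr Q j < V Q L ε j}

/-- `K₂ = max {L ≤ k ≤ m L | 𝒲(k) < Q↓(k)}`, where `m` is the cardinality of `𝒴`. -/
def K₂ (Q : PMF ℕ+) (L : ℕ) (ε : ℝ) (m : ℕ) : ℕ :=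
  sSup {k : ℕ | L ≤ k ∧ k ≤ m * L ∧ W Q L ε k < decr Q k}

/-- The mass function of the Fano-distribution of type 2. -/
def fanoType2 (Q : PMF ℕ+) (L : ℕ) (ε : ℝ) (m : ℕ) (x : ℕ+) : ℝ :=
  if (x : ℕ) < J Q L ε ∨ K₂ Q L ε m < (x : ℕ) then decr Q x
  else if (x : ℕ) ≤ L then V Q L ε (J Q L ε)
  else W Q L ε (K₂ Q L ε m)

/-! ### Unconditional entropies; an element of `𝒫(𝒳)` is given by its mass function -/

/-- The Shannon entropy `∑ₓ P(x) log (1 / P(x)) ∈ [0, ∞]`. -/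
def shannonEntropy (P : ℕ+ → ℝ) : ℝ≥0∞ := ∑' x, ENNReal.ofReal (Real.negMulLog (P x))

/-- The `ℓ_α`-norm `(∑ₓ P(x)^α)^(1/α) ∈ [0, ∞]`. -/
def lNorm (α : ℝ) (P : ℕ+ → ℝ) : ℝ≥0∞ := (∑' x, ENNReal.ofReal (P x) ^ α) ^ (1 / α)

/-- The Rényi entropy of order `α`, with the Shannon entropy at `α = 1`. -/
def renyiEntropy (α : ℝ) (P : ℕ+ → ℝ) : EReal :=
  if α = 1 then (shannonEntropy P : EReal)
  else ((1 / (1 - α) : ℝ) : EReal) * ENNReal.log (∑' x, ENNReal.ofReal (P x) ^ α)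

/-! ### Conditional entropies and the error probability of list decoding -/

section Conditional

variable {Ω 𝒴 : Type*} [MeasurableSpace Ω] [MeasurableSpace 𝒴]

/-- The mass function of the regular conditional distribution `P_{X|Y}` at `ω`. -/
def condLaw (μ : Measure Ω) [IsProbabilityMeasure μ] (X : Ω → ℕ+) (Y : Ω → 𝒴) (ω : Ω) (x : ℕ+) :
    ℝ :=
  (condDistrib X Y μ (Y ω)).real {x}

/-- The conditional Shannon entropy `E[H(P_{X|Y})]`. -/
def condShannon (μ : Measure Ω) [IsProbabilityMeasure μ] (X : Ω → ℕ+) (Y : Ω → 𝒴) : ℝ≥0∞ :=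
  ∫⁻ ω, shannonEntropy (condLaw μ X Y ω) ∂μ

/-- Arimoto's conditional Rényi entropy, with the conditional Shannon entropy at `α = 1`. -/
def arimoto (α : ℝ) (μ : Measure Ω) [IsProbabilityMeasure μ] (X : Ω → ℕ+) (Y : Ω → 𝒴) : EReal :=
  if α = 1 then (condShannon μ X Y : EReal)
  else ((α / (1 - α) : ℝ) : EReal) * ENNReal.log (∫⁻ ω, lNorm α (condLaw μ X Y ω) ∂μ)

/-- Hayashi's conditional Rényi entropy, with the conditional Shannon entropy at `α = 1`. -/
def hayashi (α : ℝ) (μ : Measure Ω) [IsProbabilityMeasure μ] (X : Ω → ℕ+) (Y : Ω → 𝒴) : EReal :=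
  if α = 1 then (condShannon μ X Y : EReal)
  else ((1 / (1 - α) : ℝ) : EReal) * ENNReal.log (∫⁻ ω, lNorm α (condLaw μ X Y ω) ^ α ∂μ)

/-- The minimum average error probability under list decoding with list size at most `L`. -/
def listError (L : ℕ) (μ : Measure Ω) (X : Ω → ℕ+) (Y : Ω → 𝒴) : ℝ :=
  ⨅ f : {f : 𝒴 → Finset ℕ+ // ∀ y, 1 ≤ (f y).card ∧ (f y).card ≤ L},
    μ.real {ω | X ω ∉ f.1 (Y ω)}

/-- `(X, Y)` is a pair of random variables on `(Ω, μ)` with `P_e^{(L)}(X | Y) ≤ ε` and `P_X = Q`. -/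
structure Feasible (Q : PMF ℕ+) (L : ℕ) (ε : ℝ) (μ : Measure Ω) (X : Ω → ℕ+) (Y : Ω → 𝒴) :
    Prop where
  measurable_X : Measurable X
  measurable_Y : Measurable Y
  law_X : μ.map X = Q.toMeasure
  error_le : listError L μ X Y ≤ ε

end Conditional

/-- The supremum of Arimoto's conditional Rényi entropy over all feasible pairs `(X, Y)`. -/
def supArimoto (α : ℝ) (Q : PMF ℕ+) (L : ℕ) (ε : ℝ) (𝒴 : Type v) [MeasurableSpace 𝒴] : EReal :=
  sSup {h : EReal | ∃ (Ω : Type u) (_ : MeasurableSpace Ω) (μ : Measure Ω)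
    (_ : IsProbabilityMeasure μ) (X : Ω → ℕ+) (Y : Ω → 𝒴),
    Feasible Q L ε μ X Y ∧ h = arimoto α μ X Y}

/-- The supremum of Hayashi's conditional Rényi entropy over all feasible pairs `(X, Y)`. -/
def supHayashi (α : ℝ) (Q : PMF ℕ+) (L : ℕ) (ε : ℝ) (𝒴 : Type v) [MeasurableSpace 𝒴] : EReal :=
  sSup {h : EReal | ∃ (Ω : Type u) (_ : MeasurableSpace Ω) (μ : Measure Ω)
    (_ : IsProbabilityMeasure μ) (X : Ω → ℕ+) (Y : Ω → 𝒴),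
    Feasible Q L ε μ X Y ∧ h = hayashi α μ X Y}

/-- The supremum of the conditional Shannon entropy over all feasible pairs `(X, Y)`. -/
def supShannon (Q : PMF ℕ+) (L : ℕ) (ε : ℝ) (𝒴 : Type v) [MeasurableSpace 𝒴] : ℝ≥0∞ :=
  sSup {h : ℝ≥0∞ | ∃ (Ω : Type u) (_ : MeasurableSpace Ω) (μ : Measure Ω)
    (_ : IsProbabilityMeasure μ) (X : Ω → ℕ+) (Y : Ω → 𝒴),
    Feasible Q L ε μ X Y ∧ h = condShannon μ X Y}

end FanoRenyi

end

open FanoRenyi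

/-!
Averaging the decreasing rearrangements of the conditional laws `P_{X|Y = y}` with the weights
`P_Y(y)` gives a decreasing distribution `p`. The concavity of entropy, and for Arimoto's version
Minkowski's inequality, bound the conditional entropies by `H_α(p)`.

The partial sums of `p` dominate those of `Q↓`. The union of the `m = |𝒴|` lists of a decoder has
at most `m L` symbols, so each list can be extended by the same `j` symbols outside of that union
without losing mass to overlaps; hence a decoder with error at most `ε` forces the first `L + j`
terms of `p` to have mass at least
`1 - ε + ∑_{x ≤ m L + j} Q↓(x) - ∑_{x ≤ m L} Q↓(x)`.
These constraints make `p` majorize `P₂`, which is checked through the excesses `∑ x, (f x - s)⁺`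
at every level `s`.

Rényi entropies decrease under majorization: integrating over the levels `s` against `s ^ (α - 2)`
turns the truncated masses `∑ x, min (f x) s` into the power sums of order `α`.
-/

namespace FanoRenyi

section Enumeration

open Filter Topology

variable {ι : Type*} {f : ι → ℝ} {e : ℕ → ι}

theorem exists_argmax_notMem [Infinite ι] (hf : ∀ i, 0 ≤ f i) (hlim : Tendsto f cofinite (𝓝 0))
    (s : Finset ι) : ∃ i ∉ s, ∀ j ∉ s, f j ≤ f i := by
  classical
  obtain ⟨i₀, hi₀⟩ := Infinite.exists_notMem_finset s
  by_cases hzero : ∀ j ∉ s, f j ≤ 0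
  · exact ⟨i₀, hi₀, fun j hj => (hzero j hj).trans (hf i₀)⟩
  push Not at hzero
  obtain ⟨i₁, hi₁, hpos⟩ := hzero
  have hfin : {j | f i₁ ≤ f j}.Finite := by
    simpa [eventually_cofinite] using hlim.eventually (gt_mem_nhds hpos)
  obtain ⟨i, hi, hmax⟩ := Finset.exists_max_image (hfin.toFinset \ s) f ⟨i₁, by simp [hi₁]⟩
  simp only [Finset.mem_sdiff, Set.Finite.mem_toFinset, Set.mem_ofPred_eq] at hi hmax
  refine ⟨i, hi.2, fun j hj => ?_⟩
  rcases le_total (f i₁) (f j) with hle | hle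
  · exact hmax j ⟨hle, hj⟩
  · exact hle.trans hi.1

/-- `e` lists distinct indices in order of decreasing value of `f`, a largest remaining value at
each step. Indices at which `f` vanishes may be missed, since infinitely many values may be
positive. -/
structure IsDecreasingEnum (f : ι → ℝ) (e : ℕ → ι) : Prop where
  injective : Function.Injective e
  le_apply : ∀ n i, (∀ k < n, e k ≠ i) → f i ≤ f (e n)

theorem exists_isDecreasingEnum [Infinite ι] (hf : ∀ i, 0 ≤ f i)
    (hlim : Tendsto f cofinite (𝓝 0)) : ∃ e, IsDecreasingEnum f e := by
  classical
  choose next hnew hmax using exists_argmax_notMem hf hlim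
  let chosen : ℕ → Finset ι := fun n => Nat.rec ∅ (fun _ s => insert (next s) s) n
  have mem_chosen : ∀ n i, i ∈ chosen n ↔ ∃ k < n, next (chosen k) = i := by
    intro n i
    induction n with
    | zero => simp [chosen]
    | succ n ih =>
      rw [show chosen (n + 1) = insert (next (chosen n)) (chosen n) from rfl, Finset.mem_insert, ih]
      simp only [Nat.lt_succ_iff_lt_or_eq, or_and_right, exists_or, exists_eq_left]
      rw [or_comm, eq_comm]
  refine ⟨fun n => next (chosen n), Function.Injective.of_lt_imp_ne fun a b hab heq =>
    hnew (chosen b) ?_, fun n i hi => hmax (chosen n) i ?_⟩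
  · exact (mem_chosen b _).2 ⟨a, hab, heq⟩
  · rw [mem_chosen]
    rintro ⟨k, hk, rfl⟩
    exact hi k hk rfl

namespace IsDecreasingEnum

theorem antitone (he : IsDecreasingEnum f e) : Antitone (f ∘ e) := fun _ _ hij =>
  he.le_apply _ _ fun _ hk => he.injective.ne (hk.trans_le hij).ne

theorem apply_eq_zero (he : IsDecreasingEnum f e) (hf : ∀ i, 0 ≤ f i)
    (hlim : Tendsto f cofinite (𝓝 0)) {i : ι} (hi : i ∉ Set.range e) : f i = 0 := by
  have hlim' : Tendsto (f ∘ e) atTop (𝓝 0) :=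
    Nat.cofinite_eq_atTop ▸ hlim.comp he.injective.tendsto_cofinite
  exact le_antisymm (ge_of_tendsto' hlim' fun n => he.le_apply n i fun k _ hk => hi ⟨k, hk⟩) (hf i)

theorem encard_lt_iff (he : IsDecreasingEnum f e) (n : ℕ) (t : ℝ) :
    {i | t < f i}.encard < (n + 1 : ℕ) ↔ f (e n) ≤ t := by
  classical
  have hcard : ∀ k, (((Finset.range k).image e : Finset ι) : Set ι).encard = k := fun k => by
    rw [Set.encard_coe_eq_coe_finsetCard, Finset.card_image_of_injective _ he.injective,
      Finset.card_range]
  constructor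
  · contrapose!
    intro hlt
    rw [← hcard]
    refine Set.encard_le_encard fun i hi => ?_
    obtain ⟨k, hk, rfl⟩ := Finset.mem_image.1 (Finset.mem_coe.1 hi)
    exact hlt.trans_le (he.antitone (Nat.lt_succ_iff.1 (Finset.mem_range.1 hk)))
  · intro hle
    have hsub : {i | t < f i} ⊆ ((Finset.range n).image e : Finset ι) := by
      intro i hi
      by_contra hmem
      refine absurd ((he.le_apply n i fun k hk hki => hmem ?_).trans hle) (not_le.2 hi)
      exact Finset.mem_coe.2 (Finset.mem_image.2 ⟨k, Finset.mem_range.2 hk, hki⟩)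
    refine ((Set.encard_le_encard hsub).trans_eq (hcard n)).trans_lt ?_
    exact_mod_cast n.lt_succ_self

theorem sum_le (he : IsDecreasingEnum f e) (hf : ∀ i, 0 ≤ f i) {T : Finset ι} {k : ℕ}
    (hT : T.card ≤ k) : ∑ i ∈ T, f i ≤ ∑ n ∈ Finset.range k, f (e n) := by
  classical
  set top := (Finset.range k).image e
  have hcard : top.card = k := by
    rw [Finset.card_image_of_injective _ he.injective, Finset.card_range]
  have hsum : ∑ n ∈ Finset.range k, f (e n) = ∑ i ∈ top, f i :=
    (Finset.sum_image he.injective.injOn).symm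
  have hmiss : (T \ top).card ≤ (top \ T).card :=
    Finset.card_sdiff_le_card_sdiff_iff.2 (hT.trans_eq hcard.symm)
  have hout : ∑ i ∈ T \ top, f i ≤ (T \ top).card • f (e k) :=
    Finset.sum_le_card_nsmul _ _ _ fun i hi => he.le_apply k i fun n hn hni =>
      (Finset.mem_sdiff.1 hi).2 (Finset.mem_image.2 ⟨n, Finset.mem_range.2 hn, hni⟩)
  have hin : (top \ T).card • f (e k) ≤ ∑ i ∈ top \ T, f i := by
    refine Finset.card_nsmul_le_sum _ _ _ fun i hi => ?_
    obtain ⟨n, hn, rfl⟩ := Finset.mem_image.1 (Finset.mem_sdiff.1 hi).1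
    exact he.antitone (Finset.mem_range.1 hn).le
  rw [hsum, ← Finset.sum_inter_add_sum_sdiff T top, ← Finset.sum_inter_add_sum_sdiff top T,
    Finset.inter_comm top T]
  exact add_le_add le_rfl <| hout.trans <|
    (nsmul_le_nsmul_left (hf _) hmiss).trans hin

end IsDecreasingEnum

end Enumeration

section DecreasingRearrangement

open Filter Topology

theorem hasSum_one_of_tsum_ofReal {ι : Type*} {f : ι → ℝ} (hf : ∀ i, 0 ≤ f i)
    (h : ∑' i, ENNReal.ofReal (f i) = 1) : HasSum f 1 := by
  have hsum : Summable f := by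
    have hne := h.trans_ne ENNReal.one_ne_top
    simpa only [ENNReal.toReal_ofReal (hf _)] using ENNReal.summable_toReal hne
  rw [← ENNReal.ofReal_tsum_of_nonneg hf hsum, ENNReal.ofReal_eq_one] at h
  exact h ▸ hsum.hasSum

variable {α : Type*}

theorem tsum_ofReal_toReal (Q : PMF α) : ∑' x, ENNReal.ofReal (Q x).toReal = 1 := by
  simp only [ENNReal.ofReal_toReal (Q.apply_ne_top _), Q.tsum_coe]

theorem hasSum_toReal (Q : PMF α) : HasSum (fun x => (Q x).toReal) 1 :=
  hasSum_one_of_tsum_ofReal (fun _ => ENNReal.toReal_nonneg) (tsum_ofReal_toReal Q)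

theorem tendsto_toReal_cofinite (Q : PMF α) : Tendsto (fun x => (Q x).toReal) cofinite (𝓝 0) :=
  (hasSum_toReal Q).summable.tendsto_cofinite_zero

theorem exists_enum [Infinite α] (Q : PMF α) : ∃ e, IsDecreasingEnum (fun x => (Q x).toReal) e :=
  exists_isDecreasingEnum (fun _ => ENNReal.toReal_nonneg) (tendsto_toReal_cofinite Q)

variable {Q : PMF ℕ+} {e : ℕ → ℕ+}

theorem decr_succ_eq (he : IsDecreasingEnum (fun x => (Q x).toReal) e) (n : ℕ) :
    decr Q (n + 1) = (Q (e n)).toReal := by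
  have hset : {t : ℝ | 0 ≤ t ∧ {x : ℕ+ | t < (Q x).toReal}.encard < ((n + 1 : ℕ) : ℕ∞)}
      = Set.Ici (Q (e n)).toReal := by
    ext t
    simp only [he.encard_lt_iff, Set.mem_ofPred_eq, Set.mem_Ici, and_iff_right_iff_imp]
    exact ENNReal.toReal_nonneg.trans
  rw [decr, hset, csInf_Ici]

theorem topSum_eq_sum_range (Q : PMF ℕ+) (k : ℕ) :
    topSum Q k = ∑ n ∈ Finset.range k, decr Q (n + 1) := by
  rw [topSum, ← Finset.Ico_add_one_right_eq_Icc, Finset.range_eq_Ico,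
    Finset.sum_Ico_add' (decr Q), zero_add]

theorem topSum_eq_sum_enum (he : IsDecreasingEnum (fun x => (Q x).toReal) e) (k : ℕ) :
    topSum Q k = ∑ n ∈ Finset.range k, (Q (e n)).toReal := by
  simp only [topSum_eq_sum_range, decr_succ_eq he]

variable (Q)

theorem decr_nonneg (i : ℕ) : 0 ≤ decr Q i :=
  Real.sInf_nonneg fun _ h => h.1

variable {Q} in
theorem decr_le_decr {i j : ℕ} (hi : 1 ≤ i) (hij : i ≤ j) : decr Q j ≤ decr Q i := by
  obtain ⟨e, he⟩ := exists_enum Q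
  obtain ⟨i, rfl⟩ := Nat.exists_eq_add_of_le' hi
  obtain ⟨j, rfl⟩ := Nat.exists_eq_add_of_le' (hi.trans hij)
  rw [decr_succ_eq he, decr_succ_eq he]
  exact he.antitone (by omega)

theorem tendsto_decr : Tendsto (fun n : ℕ => decr Q (n + 1)) atTop (𝓝 0) := by
  obtain ⟨e, he⟩ := exists_enum Q
  simp only [decr_succ_eq he]
  exact Nat.cofinite_eq_atTop ▸
    (tendsto_toReal_cofinite Q).comp he.injective.tendsto_cofinite

theorem tsum_comp_decr (Φ : ℝ → ℝ≥0∞) (hΦ : Φ 0 = 0) :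
    ∑' x : ℕ+, Φ (decr Q x) = ∑' x, Φ (Q x).toReal := by
  obtain ⟨e, he⟩ := exists_enum Q
  have hsupp : Function.support (fun x => Φ (Q x).toReal) ⊆ Set.range e := fun x hx => by
    contrapose! hx
    have hzero : (Q x).toReal = 0 :=
      he.apply_eq_zero (fun _ => ENNReal.toReal_nonneg) (tendsto_toReal_cofinite Q) hx
    rw [Function.notMem_support, hzero, hΦ]
  rw [tsum_pnat_eq_tsum_succ (f := fun n => Φ (decr Q n)), ← he.injective.tsum_eq hsupp]
  simp only [decr_succ_eq he]

theorem tsum_ofReal_decr : ∑' x : ℕ+, ENNReal.ofReal (decr Q x) = 1 :=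
  (tsum_comp_decr Q ENNReal.ofReal ENNReal.ofReal_zero).trans (tsum_ofReal_toReal Q)

theorem hasSum_decr : HasSum (fun x : ℕ+ => decr Q x) 1 :=
  hasSum_one_of_tsum_ofReal (fun _ => decr_nonneg Q _) (tsum_ofReal_decr Q)

theorem topSum_zero : topSum Q 0 = 0 := by simp [topSum]

theorem topSum_succ (k : ℕ) : topSum Q (k + 1) = topSum Q k + decr Q (k + 1) := by
  simp only [topSum_eq_sum_range, Finset.sum_range_succ]

theorem topSum_mono : Monotone (topSum Q) :=
  monotone_nat_of_le_succ fun k => by linarith [topSum_succ Q k, decr_nonneg Q (k + 1)]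

theorem topSum_nonneg (k : ℕ) : 0 ≤ topSum Q k :=
  Finset.sum_nonneg fun _ _ => decr_nonneg Q _

theorem exists_card_eq_topSum (k : ℕ) :
    ∃ T : Finset ℕ+, T.card = k ∧ ∑ x ∈ T, (Q x).toReal = topSum Q k := by
  classical
  obtain ⟨e, he⟩ := exists_enum Q
  refine ⟨(Finset.range k).image e, by simp [Finset.card_image_of_injective _ he.injective], ?_⟩
  rw [Finset.sum_image he.injective.injOn, topSum_eq_sum_enum he]

variable {Q} in
theorem sum_le_topSum {T : Finset ℕ+} {k : ℕ} (hT : T.card ≤ k) :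
    ∑ x ∈ T, (Q x).toReal ≤ topSum Q k := by
  obtain ⟨e, he⟩ := exists_enum Q
  rw [topSum_eq_sum_enum he]
  exact he.sum_le (fun _ => ENNReal.toReal_nonneg) hT

theorem topSum_le_one (k : ℕ) : topSum Q k ≤ 1 := by
  obtain ⟨T, -, hT⟩ := exists_card_eq_topSum Q k
  rw [← hT]
  exact sum_le_hasSum _ (fun _ _ => ENNReal.toReal_nonneg) (hasSum_toReal Q)

theorem decr_one_pos : 0 < decr Q 1 := by
  by_contra! hle
  have hzero : ∀ x : ℕ+, decr Q x = 0 := fun x =>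
    le_antisymm ((decr_le_decr le_rfl x.pos).trans hle) (decr_nonneg Q _)
  have hsum := tsum_ofReal_decr Q
  simp [hzero] at hsum

theorem topSum_pos {k : ℕ} (hk : 1 ≤ k) : 0 < topSum Q k := by
  have hone : topSum Q 1 = decr Q 1 := by rw [topSum_succ, topSum_zero, zero_add]
  exact (decr_one_pos Q).trans_le (hone ▸ topSum_mono Q hk)

theorem decr_succ_lt_one {k : ℕ} (hk : 1 ≤ k) : decr Q (k + 1) < 1 := by
  linarith [topSum_succ Q k, topSum_le_one Q (k + 1), topSum_pos Q hk]

theorem topSum_add_sub (k n : ℕ) :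
    topSum Q (k + n) - topSum Q k = ∑ i ∈ Finset.range n, decr Q (k + i + 1) := by
  rw [topSum_eq_sum_range, topSum_eq_sum_range, Finset.sum_range_add, add_sub_cancel_left]

theorem topSum_add_sub_le (k n : ℕ) : topSum Q (k + n) - topSum Q k ≤ n * decr Q (k + 1) := by
  rw [topSum_add_sub, ← nsmul_eq_mul]
  simpa using Finset.sum_le_card_nsmul (Finset.range n) _ (decr Q (k + 1)) fun i _ =>
    decr_le_decr (by omega) (by omega)

theorem mul_decr_le_topSum_add_sub (k n : ℕ) :
    n * decr Q (k + n) ≤ topSum Q (k + n) - topSum Q k := by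
  rw [topSum_add_sub, ← nsmul_eq_mul]
  simpa using Finset.card_nsmul_le_sum (Finset.range n) _ (decr Q (k + n)) fun i hi =>
    decr_le_decr (by omega) (by have := Finset.mem_range.1 hi; omega)

variable {Q} in
theorem exists_lt_decr_iff {s : ℝ} (hs : 0 < s) :
    ∃ n : ℕ, ∀ i, 1 ≤ i → (s < decr Q i ↔ i ≤ n) := by
  classical
  have hex : ∃ n : ℕ, decr Q (n + 1) ≤ s :=
    ((tendsto_decr Q).eventually (ge_mem_nhds hs)).exists
  refine ⟨Nat.find hex, fun i hi => ⟨fun hlt => ?_, fun hle => ?_⟩⟩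
  · by_contra! hfind
    exact absurd ((decr_le_decr (by omega) hfind).trans (Nat.find_spec hex)) (not_le.2 hlt)
  · have := Nat.find_min hex (m := i - 1) (by omega)
    rwa [Nat.sub_add_cancel hi, not_le] at this

variable {Q} in
/-- Among the `n + j` heaviest symbols at least `j` lie outside `A`; keep `j` of them. -/
theorem exists_disjoint_topSum_sub_le {A : Finset ℕ+} {n : ℕ} (hA : A.card ≤ n) (j : ℕ) :
    ∃ B : Finset ℕ+, B.card = j ∧ Disjoint A B ∧
      topSum Q (n + j) - topSum Q n ≤ ∑ x ∈ B, (Q x).toReal := by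
  classical
  obtain ⟨E, hE, hsum⟩ := exists_card_eq_topSum Q (n + j)
  obtain ⟨B, hB, hBj⟩ := Finset.exists_subset_card_eq (s := E \ A) (n := j) <| by
    have := Finset.le_card_sdiff A E
    omega
  have hBE : B ⊆ E := hB.trans Finset.sdiff_subset
  have hrest : ∑ x ∈ E \ B, (Q x).toReal ≤ topSum Q n :=
    sum_le_topSum (by rw [Finset.card_sdiff_of_subset hBE]; omega)
  refine ⟨B, hBj, (Finset.disjoint_of_subset_left hB Finset.sdiff_disjoint).symm, ?_⟩
  linarith [Finset.sum_sdiff (f := fun x => (Q x).toReal) hBE]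

end DecreasingRearrangement

section CutPoints

variable {Q : PMF ℕ+} {L : ℕ} {ε : ℝ} {m : ℕ}

variable (Q ε) in
theorem mul_V {j : ℕ} (hj : j ≤ L) :
    ((L + 1 - j : ℕ) : ℝ) * V Q L ε j = (1 - ε) - topSum Q (j - 1) := by
  have hj' : (j : ℝ) ≤ L := by exact_mod_cast hj
  rw [V, if_pos hj, Nat.cast_sub (by omega)]
  push_cast
  rw [add_sub_right_comm, mul_div_cancel₀]
  linarith

variable (Q ε) in
theorem mul_W {k : ℕ} (hk : L < k) :
    ((k - L : ℕ) : ℝ) * W Q L ε k = topSum Q k - (1 - ε) := by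
  have hk' : (L : ℝ) < k := by exact_mod_cast hk
  rw [W, if_neg hk.ne', Nat.cast_sub hk.le, mul_div_cancel₀]
  linarith

section J

theorem succ_mem_J_set (hL : 1 ≤ L) : L + 1 ∈ {j | 1 ≤ j ∧ decr Q j < V Q L ε j} := by
  refine ⟨by omega, ?_⟩
  rw [V, if_neg (by omega)]
  exact decr_succ_lt_one Q hL

theorem J_mem (hL : 1 ≤ L) : 1 ≤ J Q L ε ∧ decr Q (J Q L ε) < V Q L ε (J Q L ε) :=
  Nat.sInf_mem ⟨L + 1, succ_mem_J_set hL⟩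

theorem one_le_J (hL : 1 ≤ L) : 1 ≤ J Q L ε := (J_mem hL).1

theorem decr_J_lt_V (hL : 1 ≤ L) : decr Q (J Q L ε) < V Q L ε (J Q L ε) := (J_mem hL).2

theorem J_le_succ (hL : 1 ≤ L) : J Q L ε ≤ L + 1 := Nat.sInf_le (succ_mem_J_set hL)

theorem V_le_decr_of_lt_J {j : ℕ} (hj : 1 ≤ j) (hjJ : j < J Q L ε) : V Q L ε j ≤ decr Q j := by
  simpa [hj] using Nat.notMem_of_lt_sInf hjJ

theorem J_le_iff (hL : 1 ≤ L) : J Q L ε ≤ L ↔ topSum Q L < 1 - ε := by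
  constructor
  · intro hJ
    have hpos : (0 : ℝ) < (L + 1 - J Q L ε : ℕ) := by exact_mod_cast (by omega)
    have hone : 1 ≤ J Q L ε := one_le_J hL
    have hsum := topSum_add_sub_le Q (J Q L ε - 1) (L + 1 - J Q L ε)
    rw [show J Q L ε - 1 + (L + 1 - J Q L ε) = L by omega, Nat.sub_add_cancel hone] at hsum
    have hlt : decr Q (J Q L ε) < V Q L ε (J Q L ε) := decr_J_lt_V hL
    linarith [mul_V Q ε hJ, mul_lt_mul_of_pos_left hlt hpos]
  · intro hlt
    refine Nat.sInf_le ⟨hL, ?_⟩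
    have hV := mul_V Q ε (le_refl L)
    have hsucc := topSum_succ Q (L - 1)
    rw [Nat.sub_add_cancel hL] at hsucc
    rw [Nat.add_sub_cancel_left, Nat.cast_one, one_mul] at hV
    linarith

theorem V_J_le_decr (hJ : J Q L ε ≤ L) {j : ℕ} (hj : 1 ≤ j) (hjJ : j < J Q L ε) :
    V Q L ε (J Q L ε) ≤ decr Q j := by
  obtain ⟨i, hi⟩ : ∃ i, J Q L ε = i + 2 := ⟨J Q L ε - 2, by omega⟩
  have hprev := mul_V Q ε (show i + 1 ≤ L by omega)
  have hJV := mul_V Q ε hJ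
  have hle : V Q L ε (i + 1) ≤ decr Q (i + 1) := V_le_decr_of_lt_J (by omega) (by omega)
  have hpos : (0 : ℝ) < (L + 1 - (i + 2) : ℕ) := by exact_mod_cast (by omega)
  rw [show L + 1 - (i + 1) = L + 1 - (i + 2) + 1 by omega, Nat.cast_add_one,
    Nat.add_sub_cancel] at hprev
  rw [hi, show i + 2 - 1 = i + 1 by omega, topSum_succ] at hJV
  refine le_trans ?_ (decr_le_decr (i := j) (j := i + 1) hj (by omega))
  rw [hi]
  refine le_of_mul_le_mul_left ?_ hpos
  linarith [mul_le_mul_of_nonneg_left hle hpos.le]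

theorem V_J_nonneg (hL : 1 ≤ L) : 0 ≤ V Q L ε (J Q L ε) :=
  (decr_nonneg Q _).trans (decr_J_lt_V hL).le

end J

section Admissible

theorem Admissible.topSum_le (h : Admissible Q L ε m) : topSum Q L ≤ 1 - ε := by linarith [h.2]

theorem Admissible.le_topSum (h : Admissible Q L ε m) : 1 - ε ≤ topSum Q (m * L) := by
  linarith [h.1]

theorem Admissible.one_le (h : Admissible Q L ε m) (hL : 1 ≤ L) : 1 ≤ m := by
  by_contra! hm
  have hle := h.topSum_le.trans h.le_topSum
  rw [Nat.lt_one_iff.1 hm, zero_mul, topSum_zero] at hle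
  exact hle.not_gt (topSum_pos Q hL)

theorem V_J_le_one (hL : 1 ≤ L) (h : Admissible Q L ε m) : V Q L ε (J Q L ε) ≤ 1 := by
  rcases le_or_gt (J Q L ε) L with hJ | hJ
  · have hV := mul_V Q ε hJ
    have hcount : (1 : ℝ) ≤ (L + 1 - J Q L ε : ℕ) := by exact_mod_cast (by omega)
    have hmul := le_mul_of_one_le_left (V_J_nonneg (Q := Q) (ε := ε) hL) hcount
    linarith [h.le_topSum, topSum_le_one Q (m * L), topSum_nonneg Q (J Q L ε - 1)]
  · rw [V, if_neg hJ.not_ge]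

end Admissible

section K₂

theorem K₂_mem (hL : 1 ≤ L) (h : Admissible Q L ε m) :
    L ≤ K₂ Q L ε m ∧ K₂ Q L ε m ≤ m * L ∧ W Q L ε (K₂ Q L ε m) < decr Q (K₂ Q L ε m) := by
  refine Nat.sSup_mem (s := {k | L ≤ k ∧ k ≤ m * L ∧ W Q L ε k < decr Q k})
    ⟨L, le_rfl, Nat.le_mul_of_pos_left L (h.one_le hL), ?_⟩ ⟨m * L, fun k hk => hk.2.1⟩
  rw [W, if_pos rfl]
  linarith [decr_nonneg Q L]

theorem le_K₂ (hL : 1 ≤ L) (h : Admissible Q L ε m) : L ≤ K₂ Q L ε m := (K₂_mem hL h).1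

theorem K₂_le (hL : 1 ≤ L) (h : Admissible Q L ε m) : K₂ Q L ε m ≤ m * L := (K₂_mem hL h).2.1

theorem W_lt_decr_K₂ (hL : 1 ≤ L) (h : Admissible Q L ε m) :
    W Q L ε (K₂ Q L ε m) < decr Q (K₂ Q L ε m) := (K₂_mem hL h).2.2

theorem le_K₂_of_W_lt_decr {k : ℕ} (hLk : L ≤ k) (hk : k ≤ m * L) (hW : W Q L ε k < decr Q k) :
    k ≤ K₂ Q L ε m :=
  le_csSup ⟨m * L, fun _ hk => hk.2.1⟩ ⟨hLk, hk, hW⟩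

theorem lt_K₂_iff (hL : 1 ≤ L) (h : Admissible Q L ε m) :
    L < K₂ Q L ε m ↔ topSum Q L < 1 - ε := by
  constructor
  · intro hK
    have hpos : (0 : ℝ) < (K₂ Q L ε m - L : ℕ) := by exact_mod_cast (by omega)
    have hsum := mul_decr_le_topSum_add_sub Q L (K₂ Q L ε m - L)
    rw [Nat.add_sub_cancel' hK.le] at hsum
    linarith [mul_W Q ε hK, mul_lt_mul_of_pos_left (W_lt_decr_K₂ hL h) hpos]
  · intro hlt
    have hmL : L < m * L := (topSum_mono Q).reflect_lt (hlt.trans_le h.le_topSum)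
    have hW := mul_W Q ε (Nat.lt_succ_self L)
    rw [Nat.succ_eq_add_one, Nat.add_sub_cancel_left, Nat.cast_one, one_mul, topSum_succ] at hW
    exact le_K₂_of_W_lt_decr (by omega) hmL (by linarith)

theorem decr_succ_K₂_le_W (hK : L < K₂ Q L ε m) (hKm : K₂ Q L ε m < m * L) :
    decr Q (K₂ Q L ε m + 1) ≤ W Q L ε (K₂ Q L ε m) := by
  have hle : decr Q (K₂ Q L ε m + 1) ≤ W Q L ε (K₂ Q L ε m + 1) := by
    by_contra! hlt
    exact (le_K₂_of_W_lt_decr (by omega) hKm hlt).not_gt (Nat.lt_succ_self _)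
  have hpos : (0 : ℝ) < (K₂ Q L ε m - L : ℕ) := by exact_mod_cast (by omega)
  have hW := mul_W Q ε hK
  have hWsucc := mul_W Q ε (hK.trans (Nat.lt_succ_self _))
  rw [show (K₂ Q L ε m).succ - L = K₂ Q L ε m - L + 1 by omega, Nat.cast_add_one,
    Nat.succ_eq_add_one, topSum_succ] at hWsucc
  refine le_of_mul_le_mul_left ?_ hpos
  linarith [mul_le_mul_of_nonneg_left hle hpos.le]

theorem W_K₂_nonneg (hL : 1 ≤ L) (h : Admissible Q L ε m) (hK : L < K₂ Q L ε m) :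
    0 ≤ W Q L ε (K₂ Q L ε m) := by
  rcases (K₂_le hL h).lt_or_eq with hlt | heq
  · exact (decr_nonneg Q _).trans (decr_succ_K₂_le_W hK hlt)
  · have hpos : (0 : ℝ) < (K₂ Q L ε m - L : ℕ) := by exact_mod_cast (by omega)
    refine nonneg_of_mul_nonneg_right ?_ hpos
    rw [mul_W Q ε hK, heq]
    linarith [h.le_topSum]

theorem W_K₂_le_V_J (hL : 1 ≤ L) (h : Admissible Q L ε m) (hK : L < K₂ Q L ε m) :
    W Q L ε (K₂ Q L ε m) ≤ V Q L ε (J Q L ε) := by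
  have hJ : J Q L ε ≤ L := (J_le_iff hL).2 ((lt_K₂_iff hL h).1 hK)
  calc W Q L ε (K₂ Q L ε m) ≤ decr Q (K₂ Q L ε m) := (W_lt_decr_K₂ hL h).le
    _ ≤ decr Q (J Q L ε) := decr_le_decr (one_le_J hL) (by omega)
    _ ≤ V Q L ε (J Q L ε) := (decr_J_lt_V hL).le

end K₂

end CutPoints

section Majorization

variable {ι κ : Type*}

/-- The total mass of `f` above the level `s`. -/
noncomputable def excess (f : ι → ℝ) (s : ℝ) : ℝ≥0∞ := ∑' i, ENNReal.ofReal (f i - s)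

/-- `g` is majorized by `f`. For mass functions this is the usual comparison of the sums of the `k`
largest masses; the excesses also make sense when the two index sets differ, and no rearrangement
has to be chosen. -/
def IsMajorizedBy (g : κ → ℝ) (f : ι → ℝ) : Prop := ∀ s, 0 < s → excess g s ≤ excess f s

theorem excess_zero (f : ι → ℝ) : excess f 0 = ∑' i, ENNReal.ofReal (f i) := by
  simp only [excess, sub_zero]

theorem ofReal_sum_sub_le_excess (f : ι → ℝ) (s : ℝ) (T : Finset ι) :
    ENNReal.ofReal (∑ i ∈ T, f i - T.card * s) ≤ excess f s := by
  calc ENNReal.ofReal (∑ i ∈ T, f i - T.card * s)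
      = ENNReal.ofReal (∑ i ∈ T, (f i - s)) := by
        rw [Finset.sum_sub_distrib, Finset.sum_const, nsmul_eq_mul]
    _ ≤ ∑ i ∈ T, ENNReal.ofReal (f i - s) :=
        Finset.le_sum_of_subadditive _ ENNReal.ofReal_zero.le
          (fun _ _ => ENNReal.ofReal_add_le) T _
    _ ≤ excess f s := ENNReal.sum_le_tsum T

theorem tsum_pnat_eq_sum_range_add (h : ℕ+ → ℝ≥0∞) (k : ℕ) :
    ∑' x, h x = ∑ n ∈ Finset.range k, h n.succPNat + ∑' n, h (k + n).succPNat := by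
  rw [← Equiv.pnatEquivNat.symm.tsum_eq h]
  simp only [Equiv.pnatEquivNat_symm_apply, add_comm k]
  exact (Summable.sum_add_tsum_nat_add' (f := fun n : ℕ => h n.succPNat) ENNReal.summable).symm

variable (Q : PMF ℕ+)

theorem excess_decr_eq (s : ℝ) (k : ℕ) :
    excess (fun x : ℕ+ => decr Q x) s =
      ∑ n ∈ Finset.range k, ENNReal.ofReal (decr Q (n + 1) - s) +
        excess (fun n => decr Q (k + n + 1)) s := by
  simp only [excess, tsum_pnat_eq_sum_range_add _ k, Nat.succPNat_coe, Nat.succ_eq_add_one]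

theorem excess_decr_tail_anti (s : ℝ) {k l : ℕ} (hkl : k ≤ l) :
    excess (fun n => decr Q (l + n + 1)) s ≤ excess (fun n => decr Q (k + n + 1)) s := by
  obtain ⟨d, rfl⟩ := Nat.exists_eq_add_of_le hkl
  simpa only [add_assoc, Function.comp_def, excess] using ENNReal.tsum_comp_le_tsum_of_injective
    (add_right_injective d) fun n => ENNReal.ofReal (decr Q (k + n + 1) - s)

variable {Q} in
theorem exists_excess_decr_tail_eq {s : ℝ} (hs : 0 < s) (k : ℕ) :
    ∃ n : ℕ, 0 ≤ topSum Q (k + n) - topSum Q k - n * s ∧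
      excess (fun i => decr Q (k + i + 1)) s =
        ENNReal.ofReal (topSum Q (k + n) - topSum Q k - n * s) := by
  obtain ⟨N, hN⟩ := exists_lt_decr_iff (Q := Q) hs
  have hsum : topSum Q (k + (N - k)) - topSum Q k - (N - k : ℕ) * s
      = ∑ i ∈ Finset.range (N - k), (decr Q (k + i + 1) - s) := by
    rw [Finset.sum_sub_distrib, topSum_add_sub, Finset.sum_const, Finset.card_range, nsmul_eq_mul]
  have hpos : ∀ i ∈ Finset.range (N - k), 0 ≤ decr Q (k + i + 1) - s := fun i hi => by
    have := Finset.mem_range.1 hi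
    exact sub_nonneg.2 ((hN _ (by omega)).2 (by omega)).le
  refine ⟨N - k, hsum ▸ Finset.sum_nonneg hpos, ?_⟩
  rw [hsum, ENNReal.ofReal_sum_of_nonneg hpos, excess]
  refine tsum_eq_sum fun i hi => ENNReal.ofReal_of_nonpos (sub_nonpos.2 (not_lt.1 fun hlt => ?_))
  have := (hN _ (by omega)).1 hlt
  exact hi (Finset.mem_range.2 (by omega))

end Majorization

section FanoType2

variable {Q : PMF ℕ+} {L : ℕ} {ε : ℝ} {m : ℕ}

theorem tsum_comp_fanoType2 (hL : 1 ≤ L) (h : Admissible Q L ε m) (Φ : ℝ → ℝ≥0∞) :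
    ∑' x, Φ (fanoType2 Q L ε m x) =
      ∑ n ∈ Finset.range (J Q L ε - 1), Φ (decr Q (n + 1)) +
        (L + 1 - J Q L ε) • Φ (V Q L ε (J Q L ε)) +
        (K₂ Q L ε m - L) • Φ (W Q L ε (K₂ Q L ε m)) +
        ∑' n, Φ (decr Q (K₂ Q L ε m + n + 1)) := by
  have hJ : 1 ≤ J Q L ε := one_le_J hL
  have hJL : J Q L ε ≤ L + 1 := J_le_succ hL
  have hK : L ≤ K₂ Q L ε m := le_K₂ hL h
  rw [tsum_pnat_eq_sum_range_add _ (K₂ Q L ε m),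
    show Finset.range (K₂ Q L ε m)
      = Finset.range (J Q L ε - 1 + (L + 1 - J Q L ε) + (K₂ Q L ε m - L)) by congr 1; omega,
    Finset.sum_range_add, Finset.sum_range_add]
  congr 1
  · congr 1
    · congr 1
      · refine Finset.sum_congr rfl fun n hn => ?_
        have := Finset.mem_range.1 hn
        rw [fanoType2, Nat.succPNat_coe, if_pos (by omega)]
      · refine (Finset.sum_eq_card_nsmul fun n hn => ?_).trans (by rw [Finset.card_range])
        have := Finset.mem_range.1 hn
        rw [fanoType2, Nat.succPNat_coe, if_neg (by omega), if_pos (by omega)]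
    · refine (Finset.sum_eq_card_nsmul fun n hn => ?_).trans (by rw [Finset.card_range])
      have := Finset.mem_range.1 hn
      rw [fanoType2, Nat.succPNat_coe, if_neg (by omega), if_neg (by omega)]
  · refine tsum_congr fun n => ?_
    rw [fanoType2, Nat.succPNat_coe, if_pos (by omega)]

theorem fanoType2_eq_decr (hL : 1 ≤ L) (h : Admissible Q L ε m) (heq : ¬topSum Q L < 1 - ε) :
    fanoType2 Q L ε m = fun x : ℕ+ => decr Q x := by
  have hJ : ¬J Q L ε ≤ L := (J_le_iff hL).not.2 heq
  have hK : ¬L < K₂ Q L ε m := (lt_K₂_iff hL h).not.2 heq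
  funext x
  rw [fanoType2, if_pos (by omega)]

theorem fanoType2_nonneg (hL : 1 ≤ L) (h : Admissible Q L ε m) (x : ℕ+) :
    0 ≤ fanoType2 Q L ε m x := by
  rw [fanoType2]
  split_ifs with houter hx
  · exact decr_nonneg Q x
  · exact V_J_nonneg hL
  · exact W_K₂_nonneg hL h (by omega)

section Excess

variable (hL : 1 ≤ L) (h : Admissible Q L ε m) (hlt : topSum Q L < 1 - ε)
include hL h hlt

omit h in
theorem excess_head_eq {s : ℝ} (hs : s ≤ V Q L ε (J Q L ε)) :
    ∑ n ∈ Finset.range (J Q L ε - 1), ENNReal.ofReal (decr Q (n + 1) - s) +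
        (L + 1 - J Q L ε) • ENNReal.ofReal (V Q L ε (J Q L ε) - s) =
      ENNReal.ofReal (1 - ε - L * s) ∧ 0 ≤ 1 - ε - L * s := by
  have hJ : 1 ≤ J Q L ε := one_le_J hL
  have hJL : J Q L ε ≤ L := (J_le_iff hL).2 hlt
  have hhead : ∀ n ∈ Finset.range (J Q L ε - 1), 0 ≤ decr Q (n + 1) - s := fun n hn => by
    have := Finset.mem_range.1 hn
    exact sub_nonneg.2 (hs.trans (V_J_le_decr hJL (by omega) (by omega)))
  have hplateau : 0 ≤ (L + 1 - J Q L ε) • (V Q L ε (J Q L ε) - s) :=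
    nsmul_nonneg (sub_nonneg.2 hs) _
  have htotal : ∑ n ∈ Finset.range (J Q L ε - 1), (decr Q (n + 1) - s) +
      (L + 1 - J Q L ε) • (V Q L ε (J Q L ε) - s) = 1 - ε - L * s := by
    rw [Finset.sum_sub_distrib, ← topSum_eq_sum_range, Finset.sum_const, Finset.card_range,
      nsmul_eq_mul, nsmul_eq_mul, mul_sub, mul_V Q ε hJL, Nat.cast_sub hJ,
      Nat.cast_sub (by omega)]
    push_cast
    ring
  rw [← htotal, ENNReal.ofReal_add (Finset.sum_nonneg hhead) hplateau,
    ENNReal.ofReal_sum_of_nonneg hhead, ENNReal.ofReal_nsmul]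
  exact ⟨rfl, add_nonneg (Finset.sum_nonneg hhead) hplateau⟩

theorem excess_fanoType2_of_le_W {s : ℝ} (hs : s ≤ W Q L ε (K₂ Q L ε m)) :
    excess (fanoType2 Q L ε m) s = excess (fun x : ℕ+ => decr Q x) s := by
  have hK : L < K₂ Q L ε m := (lt_K₂_iff hL h).2 hlt
  obtain ⟨hhead, hnonneg⟩ := excess_head_eq hL hlt (hs.trans (W_K₂_le_V_J hL h hK))
  have hplateau : 0 ≤ (K₂ Q L ε m - L) • (W Q L ε (K₂ Q L ε m) - s) :=
    nsmul_nonneg (sub_nonneg.2 hs) _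
  have hdecr : ∀ n ∈ Finset.range (K₂ Q L ε m), 0 ≤ decr Q (n + 1) - s := fun n hn =>
    sub_nonneg.2 <| (hs.trans (W_lt_decr_K₂ hL h).le).trans
      (decr_le_decr (by omega) (Finset.mem_range.1 hn))
  have htotal : 1 - ε - L * s + (K₂ Q L ε m - L) • (W Q L ε (K₂ Q L ε m) - s)
      = ∑ n ∈ Finset.range (K₂ Q L ε m), (decr Q (n + 1) - s) := by
    rw [Finset.sum_sub_distrib, ← topSum_eq_sum_range, Finset.sum_const, Finset.card_range,
      nsmul_eq_mul, nsmul_eq_mul, mul_sub, mul_W Q ε hK, Nat.cast_sub hK.le]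
    ring
  rw [excess_decr_eq Q s (K₂ Q L ε m), ← ENNReal.ofReal_sum_of_nonneg hdecr, ← htotal,
    ENNReal.ofReal_add hnonneg hplateau, ← hhead, ENNReal.ofReal_nsmul]
  exact tsum_comp_fanoType2 hL h fun t => ENNReal.ofReal (t - s)

theorem excess_fanoType2_le_of_W_le {s : ℝ} (hW : W Q L ε (K₂ Q L ε m) ≤ s)
    (hV : s ≤ V Q L ε (J Q L ε)) :
    excess (fanoType2 Q L ε m) s ≤
      ENNReal.ofReal (1 - ε - L * s) + excess (fun n => decr Q (m * L + n + 1)) s := by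
  have hK : L < K₂ Q L ε m := (lt_K₂_iff hL h).2 hlt
  rw [← (excess_head_eq hL hlt hV).1, excess,
    tsum_comp_fanoType2 hL h fun t => ENNReal.ofReal (t - s),
    ENNReal.ofReal_of_nonpos (sub_nonpos.2 hW), smul_zero, add_zero]
  refine add_le_add le_rfl ?_
  rcases (K₂_le hL h).lt_or_eq with hlt' | heq
  · have hzero : ∀ n, ENNReal.ofReal (decr Q (K₂ Q L ε m + n + 1) - s) = 0 := fun n =>
      ENNReal.ofReal_of_nonpos <| sub_nonpos.2 <|
        (decr_le_decr (by omega) (by omega)).trans ((decr_succ_K₂_le_W hK hlt').trans hW)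
    simp only [hzero, tsum_zero, zero_le]
  · rw [heq, excess]

theorem excess_fanoType2_le_of_V_le {s : ℝ} (hV : V Q L ε (J Q L ε) ≤ s) :
    excess (fanoType2 Q L ε m) s ≤ excess (fun x : ℕ+ => decr Q x) s := by
  have hJL : J Q L ε ≤ L := (J_le_iff hL).2 hlt
  have hK : L < K₂ Q L ε m := (lt_K₂_iff hL h).2 hlt
  rw [excess_decr_eq Q s (J Q L ε - 1), excess,
    tsum_comp_fanoType2 hL h fun t => ENNReal.ofReal (t - s),
    ENNReal.ofReal_of_nonpos (sub_nonpos.2 hV),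
    ENNReal.ofReal_of_nonpos (sub_nonpos.2 ((W_K₂_le_V_J hL h hK).trans hV)),
    smul_zero, smul_zero, add_zero, add_zero]
  exact add_le_add le_rfl (excess_decr_tail_anti Q s (by omega))

end Excess

theorem tsum_ofReal_fanoType2_eq_one (hL : 1 ≤ L) (h : Admissible Q L ε m) :
    ∑' x, ENNReal.ofReal (fanoType2 Q L ε m x) = 1 := by
  by_cases hlt : topSum Q L < 1 - ε
  · have hW : 0 ≤ W Q L ε (K₂ Q L ε m) := W_K₂_nonneg hL h ((lt_K₂_iff hL h).2 hlt)
    rw [← excess_zero, excess_fanoType2_of_le_W hL h hlt hW, excess_zero, tsum_ofReal_decr]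
  · rw [fanoType2_eq_decr hL h hlt, tsum_ofReal_decr]

theorem hasSum_fanoType2 (hL : 1 ≤ L) (h : Admissible Q L ε m) : HasSum (fanoType2 Q L ε m) 1 :=
  hasSum_one_of_tsum_ofReal (fanoType2_nonneg hL h) (tsum_ofReal_fanoType2_eq_one hL h)

theorem isMajorizedBy_of_topSum_le {ι : Type*} {p : ι → ℝ}
    (htop : ∀ k, ∃ T : Finset ι, T.card = k ∧ topSum Q k ≤ ∑ x ∈ T, p x) :
    IsMajorizedBy (fun x : ℕ+ => decr Q x) p := by
  intro s hs
  obtain ⟨n, -, htail⟩ := exists_excess_decr_tail_eq (Q := Q) hs 0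
  obtain ⟨T, hT, hsum⟩ := htop n
  rw [excess_decr_eq Q s 0, Finset.sum_range_zero, zero_add, htail]
  refine le_trans (ENNReal.ofReal_le_ofReal ?_) (ofReal_sum_sub_le_excess p s T)
  rw [zero_add, topSum_zero, hT]
  linarith

theorem fanoType2_isMajorizedBy {ι : Type*} {p : ι → ℝ} (hL : 1 ≤ L) (h : Admissible Q L ε m)
    (htop : ∀ k, ∃ T : Finset ι, T.card = k ∧ topSum Q k ≤ ∑ x ∈ T, p x)
    (hlist : ∀ j, ∃ T : Finset ι, T.card = L + j ∧
      1 - ε + (topSum Q (m * L + j) - topSum Q (m * L)) ≤ ∑ x ∈ T, p x) :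
    IsMajorizedBy (fanoType2 Q L ε m) p := by
  intro s hs
  have hdecr := isMajorizedBy_of_topSum_le htop s hs
  by_cases hlt : topSum Q L < 1 - ε
  · rcases le_total s (W Q L ε (K₂ Q L ε m)) with hW | hW
    · exact (excess_fanoType2_of_le_W hL h hlt hW).trans_le hdecr
    rcases le_total (V Q L ε (J Q L ε)) s with hV | hV
    · exact (excess_fanoType2_le_of_V_le hL h hlt hV).trans hdecr
    obtain ⟨j, hj, htail⟩ := exists_excess_decr_tail_eq (Q := Q) hs (m * L)
    obtain ⟨T, hT, hsum⟩ := hlist j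
    refine (excess_fanoType2_le_of_W_le hL h hlt hW hV).trans ?_
    rw [htail, ← ENNReal.ofReal_add (excess_head_eq hL hlt hV).2 hj]
    refine le_trans (ENNReal.ofReal_le_ofReal ?_) (ofReal_sum_sub_le_excess p s T)
    rw [hT, Nat.cast_add]
    linarith
  · rwa [fanoType2_eq_decr hL h hlt]

end FanoType2

section CapMixture

open Set intervalIntegral

/-- The mixture of the truncations `min t s` over the levels `s ∈ (0, 1]`, with weights
`s ^ (α - 2)`: up to a linear term and a constant factor it is `t ^ α`, and `negMulLog t` when
`α = 1`. -/
noncomputable def capMixture (α t : ℝ) : ℝ≥0∞ :=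
  ∫⁻ s in Ioc 0 1, ENNReal.ofReal (s ^ (α - 2)) * ENNReal.ofReal (min t s)

theorem lintegral_Ioc_ofReal_rpow {a b r : ℝ} (ha : 0 ≤ a) (hab : a ≤ b)
    (hint : IntervalIntegrable (fun s : ℝ => s ^ r) volume a b) :
    ∫⁻ s in Ioc a b, ENNReal.ofReal (s ^ r) = ENNReal.ofReal (∫ s in a..b, s ^ r) := by
  rw [integral_of_le hab, ofReal_integral_eq_lintegral_ofReal
    ((intervalIntegrable_iff_integrableOn_Ioc_of_le hab).1 hint)]
  filter_upwards [ae_restrict_mem measurableSet_Ioc] with s hs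
  exact Real.rpow_nonneg (ha.trans hs.1.le) r

theorem capMixture_zero {α : ℝ} : capMixture α 0 = 0 := by
  rw [capMixture, setLIntegral_congr_fun (g := fun _ => 0) measurableSet_Ioc, lintegral_zero]
  intro s hs
  simp only [min_eq_left hs.1.le, ENNReal.ofReal_zero, mul_zero]

theorem capMixture_eq {α t : ℝ} (hα : 0 < α) (ht0 : 0 < t) (ht1 : t ≤ 1) :
    capMixture α t = ENNReal.ofReal (t ^ α / α + t * ∫ s in t..1, s ^ (α - 2)) := by
  have hlow : ∫⁻ s in Ioc 0 t, ENNReal.ofReal (s ^ (α - 2)) * ENNReal.ofReal (min t s) =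
      ENNReal.ofReal (t ^ α / α) := by
    have hpow : ∫ s in (0 : ℝ)..t, s ^ (α - 1) = t ^ α / α := by
      rw [integral_rpow (Or.inl (by linarith)), sub_add_cancel, Real.zero_rpow hα.ne', sub_zero]
    rw [← hpow, ← lintegral_Ioc_ofReal_rpow le_rfl ht0.le (intervalIntegrable_rpow' (by linarith))]
    refine setLIntegral_congr_fun measurableSet_Ioc fun s hs => ?_
    rw [min_eq_right hs.2, ← ENNReal.ofReal_mul (Real.rpow_nonneg hs.1.le _),
      ← Real.rpow_add_one hs.1.ne', show α - 2 + 1 = α - 1 by ring]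
  have hhigh : ∫⁻ s in Ioc t 1, ENNReal.ofReal (s ^ (α - 2)) * ENNReal.ofReal (min t s) =
      ENNReal.ofReal (t * ∫ s in t..1, s ^ (α - 2)) := by
    have hint : IntervalIntegrable (fun s : ℝ => s ^ (α - 2)) volume t 1 :=
      intervalIntegrable_rpow (Or.inr (notMem_uIcc_of_lt ht0 one_pos))
    rw [ENNReal.ofReal_mul ht0.le, ← lintegral_Ioc_ofReal_rpow ht0.le ht1 hint, mul_comm,
      ← lintegral_mul_const' _ _ ENNReal.ofReal_ne_top]
    refine setLIntegral_congr_fun measurableSet_Ioc fun s hs => ?_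
    rw [min_eq_left hs.1.le]
  have hnonneg : 0 ≤ ∫ s in t..1, s ^ (α - 2) :=
    integral_nonneg ht1 fun s hs => Real.rpow_nonneg (ht0.le.trans hs.1) _
  rw [capMixture, ← Ioc_union_Ioc_eq_Ioc ht0.le ht1, lintegral_union measurableSet_Ioc
    (Ioc_disjoint_Ioc_of_le le_rfl), hlow, hhigh, ENNReal.ofReal_add (by positivity)
    (mul_nonneg ht0.le hnonneg)]

theorem capMixture_eq_of_ne_one {α t : ℝ} (hα : 0 < α) (hα1 : α ≠ 1) (ht0 : 0 ≤ t) (ht1 : t ≤ 1) :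
    capMixture α t = ENNReal.ofReal ((t - t ^ α / α) / (α - 1)) := by
  rcases ht0.eq_or_lt with rfl | ht0
  · rw [capMixture_zero, Real.zero_rpow hα.ne', zero_div, sub_zero, zero_div, ENNReal.ofReal_zero]
  have hα1' : α - 1 ≠ 0 := sub_ne_zero.2 hα1
  have hint : ∫ s in t..1, s ^ (α - 2) = (1 - t ^ (α - 1)) / (α - 1) := by
    rw [integral_rpow (Or.inr ⟨by contrapose! hα1; linarith, notMem_uIcc_of_lt ht0 one_pos⟩),
      show α - 2 + 1 = α - 1 by ring, Real.one_rpow]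
  rw [capMixture_eq hα ht0 ht1, hint, Real.rpow_sub_one ht0.ne']
  congr 1
  field_simp
  ring

theorem capMixture_one_eq {t : ℝ} (ht0 : 0 ≤ t) (ht1 : t ≤ 1) :
    capMixture 1 t = ENNReal.ofReal t + ENNReal.ofReal (Real.negMulLog t) := by
  rcases ht0.eq_or_lt with rfl | ht0
  · rw [capMixture_zero, Real.negMulLog_zero, ENNReal.ofReal_zero, add_zero]
  have hint : ∫ s in t..1, s ^ ((1 : ℝ) - 2) = -Real.log t := by
    simp only [show (1 : ℝ) - 2 = -1 by norm_num, Real.rpow_neg_one]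
    rw [integral_inv_of_pos ht0 one_pos, one_div, Real.log_inv]
  rw [capMixture_eq one_pos ht0 ht1, hint, Real.rpow_one, div_one, ← ENNReal.ofReal_add ht0.le
    (Real.negMulLog_nonneg ht0.le ht1), Real.negMulLog, neg_mul, mul_neg]

theorem capMixture_add_of_lt_one {α t : ℝ} (hα : 0 < α) (hα1 : α < 1) (ht0 : 0 ≤ t) (ht1 : t ≤ 1) :
    capMixture α t + ENNReal.ofReal (1 - α)⁻¹ * ENNReal.ofReal t =
      ENNReal.ofReal (α * (1 - α))⁻¹ * ENNReal.ofReal t ^ α := by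
  have hpos : 0 < 1 - α := sub_pos.2 hα1
  have hle : t ≤ t ^ α := Real.self_le_rpow_of_le_one ht0 ht1 hα1.le
  have hdiv : t ^ α ≤ t ^ α / α := le_div_self (by positivity) hα hα1.le
  rw [capMixture_eq_of_ne_one hα hα1.ne ht0 ht1, ENNReal.ofReal_rpow_of_nonneg ht0 hα.le,
    ← ENNReal.ofReal_mul (by positivity), ← ENNReal.ofReal_mul (by positivity),
    ← ENNReal.ofReal_add (div_nonneg_of_nonpos (by linarith) (by linarith)) (by positivity)]
  congr 1
  have : α - 1 ≠ 0 := by linarith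
  field_simp
  ring

theorem capMixture_add_of_one_lt {α t : ℝ} (hα1 : 1 < α) (ht0 : 0 ≤ t) (ht1 : t ≤ 1) :
    capMixture α t + ENNReal.ofReal (α * (α - 1))⁻¹ * ENNReal.ofReal t ^ α =
      ENNReal.ofReal (α - 1)⁻¹ * ENNReal.ofReal t := by
  have hα : 0 < α := one_pos.trans hα1
  have hpos : 0 < α - 1 := sub_pos.2 hα1
  have hle : t ^ α ≤ t := Real.rpow_le_self_of_le_one ht0 ht1 hα1.le
  have hdiv : t ^ α / α ≤ t ^ α := div_le_self (by positivity) hα1.le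
  rw [capMixture_eq_of_ne_one hα hα1.ne' ht0 ht1, ENNReal.ofReal_rpow_of_nonneg ht0 hα.le,
    ← ENNReal.ofReal_mul (by positivity), ← ENNReal.ofReal_mul (by positivity),
    ← ENNReal.ofReal_add (div_nonneg (by linarith) hpos.le) (by positivity)]
  congr 1
  field_simp
  ring

end CapMixture

section Monotonicity

variable {ι κ : Type*} {f : ι → ℝ} {g : κ → ℝ}

theorem le_of_add_eq_add_of_le {a b c d : ℝ≥0∞} (h : a + b = c + d) (hac : a ≤ c) (hc : c ≠ ⊤) :
    d ≤ b :=
  (ENNReal.add_le_add_iff_left hc).1 <| h ▸ add_le_add hac le_rfl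

theorem tsum_ofReal_eq_one (hf : ∀ i, 0 ≤ f i) (hf1 : HasSum f 1) :
    ∑' i, ENNReal.ofReal (f i) = 1 := by
  rw [← ENNReal.ofReal_tsum_of_nonneg hf hf1.summable, hf1.tsum_eq, ENNReal.ofReal_one]

theorem le_one_of_hasSum (hf : ∀ i, 0 ≤ f i) (hf1 : HasSum f 1) (i : ι) : f i ≤ 1 :=
  le_hasSum hf1 i fun j _ => hf j

theorem excess_add_tsum_min (hf : ∀ i, 0 ≤ f i) (hf1 : HasSum f 1) {s : ℝ} (hs : 0 ≤ s) :
    excess f s + ∑' i, ENNReal.ofReal (min (f i) s) = 1 := by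
  rw [excess, ← ENNReal.tsum_add, ← tsum_ofReal_eq_one hf hf1]
  refine tsum_congr fun i => ?_
  rcases le_total (f i) s with hle | hle
  · rw [min_eq_left hle, ENNReal.ofReal_of_nonpos (sub_nonpos.2 hle), zero_add]
  · rw [min_eq_right hle, ← ENNReal.ofReal_add (sub_nonneg.2 hle) hs, sub_add_cancel]

theorem tsum_capMixture_add_of_lt_one (hf : ∀ i, 0 ≤ f i) (hf1 : HasSum f 1) {α : ℝ} (hα : 0 < α)
    (hα1 : α < 1) : ∑' i, capMixture α (f i) + ENNReal.ofReal (1 - α)⁻¹ =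
      ENNReal.ofReal (α * (1 - α))⁻¹ * ∑' i, ENNReal.ofReal (f i) ^ α := by
  have hterm i := capMixture_add_of_lt_one hα hα1 (hf i) (le_one_of_hasSum hf hf1 i)
  rw [← ENNReal.tsum_mul_left, ← tsum_congr hterm, ENNReal.tsum_add, ENNReal.tsum_mul_left,
    tsum_ofReal_eq_one hf hf1, mul_one]

theorem tsum_capMixture_add_of_one_lt (hf : ∀ i, 0 ≤ f i) (hf1 : HasSum f 1) {α : ℝ}
    (hα1 : 1 < α) : ∑' i, capMixture α (f i) +
      ENNReal.ofReal (α * (α - 1))⁻¹ * ∑' i, ENNReal.ofReal (f i) ^ α =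
        ENNReal.ofReal (α - 1)⁻¹ := by
  have hterm i := capMixture_add_of_one_lt hα1 (hf i) (le_one_of_hasSum hf hf1 i)
  rw [← ENNReal.tsum_mul_left, ← ENNReal.tsum_add, tsum_congr hterm, ENNReal.tsum_mul_left,
    tsum_ofReal_eq_one hf hf1, mul_one]

theorem tsum_capMixture_one (hf : ∀ i, 0 ≤ f i) (hf1 : HasSum f 1) :
    ∑' i, capMixture 1 (f i) = 1 + ∑' i, ENNReal.ofReal (Real.negMulLog (f i)) := by
  have hterm i := capMixture_one_eq (hf i) (le_one_of_hasSum hf hf1 i)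
  rw [tsum_congr hterm, ENNReal.tsum_add, tsum_ofReal_eq_one hf hf1]

namespace IsMajorizedBy

variable (h : IsMajorizedBy g f) (hf : ∀ i, 0 ≤ f i) (hf1 : HasSum f 1) (hg : ∀ j, 0 ≤ g j)
  (hg1 : HasSum g 1)
include h hf hf1 hg hg1

theorem tsum_min_le {s : ℝ} (hs : 0 < s) :
    ∑' i, ENNReal.ofReal (min (f i) s) ≤ ∑' j, ENNReal.ofReal (min (g j) s) := by
  have hsum_f := excess_add_tsum_min hf hf1 hs.le
  refine le_of_add_eq_add_of_le ((excess_add_tsum_min hg hg1 hs.le).trans hsum_f.symm) (h s hs) ?_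
  exact ne_top_of_le_ne_top ENNReal.one_ne_top (le_self_add.trans_eq hsum_f)

variable [Countable ι] [Countable κ]

theorem tsum_capMixture_le (α : ℝ) : ∑' i, capMixture α (f i) ≤ ∑' j, capMixture α (g j) := by
  have hmeas : ∀ t : ℝ, Measurable fun s : ℝ =>
      ENNReal.ofReal (s ^ (α - 2)) * ENNReal.ofReal (min t s) := fun t => by fun_prop
  simp only [capMixture]
  rw [← lintegral_tsum fun i => (hmeas (f i)).aemeasurable,
    ← lintegral_tsum fun j => (hmeas (g j)).aemeasurable]
  refine setLIntegral_mono' measurableSet_Ioc fun s hs => ?_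
  rw [ENNReal.tsum_mul_left, ENNReal.tsum_mul_left]
  exact mul_le_mul_right (h.tsum_min_le hf hf1 hg hg1 hs.1) _

theorem tsum_rpow_le_of_lt_one {α : ℝ} (hα : 0 < α) (hα1 : α < 1) :
    ∑' i, ENNReal.ofReal (f i) ^ α ≤ ∑' j, ENNReal.ofReal (g j) ^ α := by
  have hc : ENNReal.ofReal (α * (1 - α))⁻¹ ≠ 0 := by
    rw [Ne, ENNReal.ofReal_eq_zero, not_le]
    exact inv_pos.2 (mul_pos hα (sub_pos.2 hα1))
  rw [← ENNReal.mul_le_mul_iff_right hc ENNReal.ofReal_ne_top,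
    ← tsum_capMixture_add_of_lt_one hf hf1 hα hα1, ← tsum_capMixture_add_of_lt_one hg hg1 hα hα1]
  exact add_le_add (h.tsum_capMixture_le hf hf1 hg hg1 α) le_rfl

theorem tsum_rpow_le_of_one_lt {α : ℝ} (hα1 : 1 < α) :
    ∑' j, ENNReal.ofReal (g j) ^ α ≤ ∑' i, ENNReal.ofReal (f i) ^ α := by
  have hc : ENNReal.ofReal (α * (α - 1))⁻¹ ≠ 0 := by
    rw [Ne, ENNReal.ofReal_eq_zero, not_le]
    exact inv_pos.2 (mul_pos (one_pos.trans hα1) (sub_pos.2 hα1))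
  have hsum_g := tsum_capMixture_add_of_one_lt hg hg1 hα1
  rw [← ENNReal.mul_le_mul_iff_right hc ENNReal.ofReal_ne_top]
  refine le_of_add_eq_add_of_le ((tsum_capMixture_add_of_one_lt hf hf1 hα1).trans hsum_g.symm)
    (h.tsum_capMixture_le hf hf1 hg hg1 α) ?_
  exact ne_top_of_le_ne_top ENNReal.ofReal_ne_top (le_self_add.trans_eq hsum_g)

theorem tsum_negMulLog_le :
    ∑' i, ENNReal.ofReal (Real.negMulLog (f i)) ≤ ∑' j, ENNReal.ofReal (Real.negMulLog (g j)) := by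
  rw [← ENNReal.add_le_add_iff_left ENNReal.one_ne_top, ← tsum_capMixture_one hf hf1,
    ← tsum_capMixture_one hg hg1]
  exact h.tsum_capMixture_le hf hf1 hg hg1 1

end IsMajorizedBy

section Renyi

variable {P R : ℕ+ → ℝ}

theorem renyiEntropy_eq_log_lNorm {α : ℝ} (hα : 0 < α) (hα1 : α ≠ 1) (P : ℕ+ → ℝ) :
    renyiEntropy α P = ((α / (1 - α) : ℝ) : EReal) * ENNReal.log (lNorm α P) := by
  rw [renyiEntropy, if_neg hα1, lNorm, ENNReal.log_rpow, ← mul_assoc, ← EReal.coe_mul]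
  congr 3
  field_simp

theorem tsum_ofReal_rpow {ι : Type*} {α : ℝ} (hα : 0 ≤ α) {f : ι → ℝ} (hf : ∀ i, 0 ≤ f i) :
    ∑' i, ENNReal.ofReal (f i) ^ α = ∑' i, ENNReal.ofReal (f i ^ α) :=
  tsum_congr fun i => ENNReal.ofReal_rpow_of_nonneg (hf i) hα

theorem mul_log_le_mul_log_of_nonneg {c : ℝ} (hc : 0 ≤ c) {a b : ℝ≥0∞} (h : a ≤ b) :
    (c : EReal) * ENNReal.log a ≤ (c : EReal) * ENNReal.log b :=
  mul_le_mul_of_nonneg_left (ENNReal.log_le_log h) (by exact_mod_cast hc)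

theorem mul_log_le_mul_log_of_nonpos {c : ℝ} (hc : c ≤ 0) {a b : ℝ≥0∞} (h : b ≤ a) :
    (c : EReal) * ENNReal.log a ≤ (c : EReal) * ENNReal.log b := by
  have hneg := mul_log_le_mul_log_of_nonneg (neg_nonneg.2 hc) h
  rwa [EReal.coe_neg, neg_mul, neg_mul, EReal.neg_le_neg_iff] at hneg

theorem IsMajorizedBy.shannonEntropy_le (h : IsMajorizedBy R P) (hP : ∀ x, 0 ≤ P x)
    (hP1 : HasSum P 1) (hR : ∀ x, 0 ≤ R x) (hR1 : HasSum R 1) :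
    shannonEntropy P ≤ shannonEntropy R :=
  h.tsum_negMulLog_le hP hP1 hR hR1

theorem IsMajorizedBy.renyiEntropy_le (h : IsMajorizedBy R P) (hP : ∀ x, 0 ≤ P x)
    (hP1 : HasSum P 1) (hR : ∀ x, 0 ≤ R x) (hR1 : HasSum R 1) {α : ℝ} (hα : 0 < α) :
    renyiEntropy α P ≤ renyiEntropy α R := by
  rcases lt_trichotomy α 1 with hα1 | rfl | hα1
  · rw [renyiEntropy, renyiEntropy, if_neg hα1.ne, if_neg hα1.ne]
    exact mul_log_le_mul_log_of_nonneg (one_div_nonneg.2 (sub_nonneg.2 hα1.le))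
      (h.tsum_rpow_le_of_lt_one hP hP1 hR hR1 hα hα1)
  · rw [renyiEntropy, renyiEntropy, if_pos rfl, if_pos rfl]
    exact EReal.coe_ennreal_le_coe_ennreal_iff.2 (h.shannonEntropy_le hP hP1 hR hR1)
  · rw [renyiEntropy, renyiEntropy, if_neg hα1.ne', if_neg hα1.ne']
    exact mul_log_le_mul_log_of_nonpos (one_div_nonpos.2 (sub_nonpos.2 hα1.le))
      (h.tsum_rpow_le_of_one_lt hP hP1 hR hR1 hα1)

end Renyi

end Monotonicity

section Minkowski

variable {ι κ : Type*} {p : ℝ}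

theorem Lp_sum_sum_le (hp : 1 ≤ p) (s : Finset ι) (t : Finset κ) (f : ι → κ → ℝ≥0∞) :
    (∑ x ∈ t, (∑ i ∈ s, f i x) ^ p) ^ (1 / p) ≤ ∑ i ∈ s, (∑ x ∈ t, f i x ^ p) ^ (1 / p) := by
  classical
  have hp0 : 0 < p := zero_lt_one.trans_le hp
  induction s using Finset.induction_on with
  | empty => simp [hp0]
  | insert a s ha ih =>
    simp only [Finset.sum_insert ha]
    exact (ENNReal.Lp_add_le t _ _ hp).trans (add_le_add le_rfl ih)

theorem Lp_tsum_tsum_le (hp : 1 ≤ p) (f : ι → κ → ℝ≥0∞) :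
    (∑' x, (∑' i, f i x) ^ p) ^ (1 / p) ≤ ∑' i, (∑' x, f i x ^ p) ^ (1 / p) := by
  have hp0 : 0 ≤ 1 / p := one_div_nonneg.2 (zero_le_one.trans hp)
  have hfinite (s : Finset ι) (t : Finset κ) :
      (∑ x ∈ t, (∑ i ∈ s, f i x) ^ p) ^ (1 / p) ≤ ∑' i, (∑' x, f i x ^ p) ^ (1 / p) :=
    (Lp_sum_sum_le hp s t f).trans <| (Finset.sum_le_sum fun i _ =>
      ENNReal.rpow_le_rpow (ENNReal.sum_le_tsum t) hp0).trans (ENNReal.sum_le_tsum s)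
  have hrow (t : Finset κ) :
      (∑ x ∈ t, (∑' i, f i x) ^ p) ^ (1 / p) ≤ ∑' i, (∑' x, f i x ^ p) ^ (1 / p) :=
    le_of_tendsto' ((ENNReal.continuous_rpow_const.tendsto _).comp <| tendsto_finsetSum t
      fun x _ => (ENNReal.continuous_rpow_const.tendsto _).comp
        (ENNReal.summable (f := fun i => f i x)).hasSum) fun s => hfinite s t
  exact le_of_tendsto' ((ENNReal.continuous_rpow_const.tendsto _).comp ENNReal.summable.hasSum)
    hrow

/-- The inequality for `α ≤ 1` is Minkowski's for the exponent `1 / α` and the functions `f i ^ α`,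
with the two summations exchanged. -/
theorem tsum_Lp_le_Lp_tsum {α : ℝ} (hα0 : 0 < α) (hα : α ≤ 1) (f : ι → κ → ℝ≥0∞) :
    ∑' i, (∑' x, f i x ^ α) ^ (1 / α) ≤ (∑' x, (∑' i, f i x) ^ α) ^ (1 / α) := by
  have h := Lp_tsum_tsum_le ((one_le_div hα0).2 hα) fun x i => f i x ^ α
  simp only [← ENNReal.rpow_mul, mul_one_div_cancel hα0.ne', ENNReal.rpow_one,
    one_div_one_div] at h
  rw [one_div α] at h ⊢
  exact (ENNReal.le_rpow_inv_iff hα0).2 h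

end Minkowski

section Jensen

variable {ι κ : Type*} [Fintype ι] {w : ι → ℝ} {G : ℝ → ℝ} {s : Set ℝ} {d : ι → κ → ℝ}

theorem sum_ofReal_mul_tsum_ofReal (hw : ∀ i, 0 ≤ w i) {g : ι → κ → ℝ} (hg : ∀ i x, 0 ≤ g i x) :
    ∑ i, ENNReal.ofReal (w i) * ∑' x, ENNReal.ofReal (g i x) =
      ∑' x, ENNReal.ofReal (∑ i, w i * g i x) := by
  simp_rw [← ENNReal.tsum_mul_left, ← ENNReal.ofReal_mul (hw _)]
  rw [← Summable.tsum_finsetSum fun _ _ => ENNReal.summable]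
  exact tsum_congr fun x =>
    (ENNReal.ofReal_sum_of_nonneg fun i _ => mul_nonneg (hw i) (hg i x)).symm

theorem sum_tsum_ofReal_le_of_concaveOn (hw : ∀ i, 0 ≤ w i) (hw1 : ∑ i, w i = 1)
    (hG : ConcaveOn ℝ s G) (hG0 : ∀ t ∈ s, 0 ≤ G t) (hd : ∀ i x, d i x ∈ s) :
    ∑ i, ENNReal.ofReal (w i) * ∑' x, ENNReal.ofReal (G (d i x)) ≤
      ∑' x, ENNReal.ofReal (G (∑ i, w i * d i x)) := by
  rw [sum_ofReal_mul_tsum_ofReal hw fun i x => hG0 _ (hd i x)]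
  exact ENNReal.tsum_le_tsum fun x => ENNReal.ofReal_le_ofReal <|
    hG.le_map_sum (fun i _ => hw i) hw1 fun i _ => hd i x

theorem tsum_ofReal_le_of_convexOn (hw : ∀ i, 0 ≤ w i) (hw1 : ∑ i, w i = 1)
    (hG : ConvexOn ℝ s G) (hG0 : ∀ t ∈ s, 0 ≤ G t) (hd : ∀ i x, d i x ∈ s) :
    ∑' x, ENNReal.ofReal (G (∑ i, w i * d i x)) ≤
      ∑ i, ENNReal.ofReal (w i) * ∑' x, ENNReal.ofReal (G (d i x)) := by
  rw [sum_ofReal_mul_tsum_ofReal hw fun i x => hG0 _ (hd i x)]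
  exact ENNReal.tsum_le_tsum fun x => ENNReal.ofReal_le_ofReal <|
    hG.map_sum_le (fun i _ => hw i) hw1 fun i _ => hd i x

end Jensen

section Mixture

variable {𝒴 : Type*} [Fintype 𝒴]

/-- `Q` is the mixture of the distributions `p y` with weights `w y`; in the application these are
the conditional distributions `P_{X|Y=y}` and the probabilities `P_Y(y)`. -/
structure IsMixture (w : 𝒴 → ℝ) (p : 𝒴 → PMF ℕ+) (Q : PMF ℕ+) : Prop where
  nonneg : ∀ y, 0 ≤ w y
  sum_eq_one : ∑ y, w y = 1
  mass_eq : ∀ x, (Q x).toReal = ∑ y, w y * (p y x).toReal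

/-- The mixture of the decreasing rearrangements of the distributions `p y`. It is itself
nonincreasing, and its first `k` terms add up to the best success probability with lists of
length `k`. -/
noncomputable def avgDecr (w : 𝒴 → ℝ) (p : 𝒴 → PMF ℕ+) (x : ℕ+) : ℝ := ∑ y, w y * decr (p y) x

variable {w : 𝒴 → ℝ} {p : 𝒴 → PMF ℕ+} {Q : PMF ℕ+}

theorem exists_sum_avgDecr_eq (w : 𝒴 → ℝ) (p : 𝒴 → PMF ℕ+) (k : ℕ) :
    ∃ T : Finset ℕ+, T.card = k ∧ ∑ x ∈ T, avgDecr w p x = ∑ y, w y * topSum (p y) k := by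
  refine ⟨(Finset.range k).map ⟨Nat.succPNat, Nat.succPNat_injective⟩, by simp, ?_⟩
  simp only [Finset.sum_map, Function.Embedding.coeFn_mk, avgDecr, Nat.succPNat_coe,
    topSum_eq_sum_range, Finset.mul_sum]
  exact Finset.sum_comm

namespace IsMixture

theorem sum_eq (h : IsMixture w p Q) (T : Finset ℕ+) :
    ∑ x ∈ T, (Q x).toReal = ∑ y, w y * ∑ x ∈ T, (p y x).toReal := by
  simp_rw [h.mass_eq, Finset.mul_sum]
  exact Finset.sum_comm

theorem avgDecr_nonneg (h : IsMixture w p Q) (x : ℕ+) : 0 ≤ avgDecr w p x :=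
  Finset.sum_nonneg fun y _ => mul_nonneg (h.nonneg y) (decr_nonneg _ _)

theorem hasSum_avgDecr (h : IsMixture w p Q) : HasSum (avgDecr w p) 1 := by
  have hsum := hasSum_sum (s := Finset.univ) fun y (_ : y ∈ Finset.univ) =>
    (hasSum_decr (p y)).mul_left (w y)
  simp only [mul_one, h.sum_eq_one] at hsum
  exact hsum

theorem sum_list_le (h : IsMixture w p Q) {k : ℕ} {T : 𝒴 → Finset ℕ+}
    (hT : ∀ y, (T y).card ≤ k) :
    ∑ y, w y * ∑ x ∈ T y, (p y x).toReal ≤ ∑ y, w y * topSum (p y) k :=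
  Finset.sum_le_sum fun y _ => mul_le_mul_of_nonneg_left (sum_le_topSum (hT y)) (h.nonneg y)

theorem topSum_le (h : IsMixture w p Q) (k : ℕ) : topSum Q k ≤ ∑ y, w y * topSum (p y) k := by
  obtain ⟨T, hT, hsum⟩ := exists_card_eq_topSum Q k
  rw [← hsum, h.sum_eq]
  exact h.sum_list_le fun _ => hT.le

/-- All lists are extended by the same `j` symbols, chosen outside the union of the lists. -/
theorem sum_list_add_topSum_sub_le (h : IsMixture w p Q) {L : ℕ} {f : 𝒴 → Finset ℕ+}
    (hf : ∀ y, (f y).card ≤ L) (j : ℕ) :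
    ∑ y, w y * ∑ x ∈ f y, (p y x).toReal +
        (topSum Q (Fintype.card 𝒴 * L + j) - topSum Q (Fintype.card 𝒴 * L)) ≤
      ∑ y, w y * topSum (p y) (L + j) := by
  classical
  have hunion : (Finset.univ.biUnion f).card ≤ Fintype.card 𝒴 * L :=
    Finset.card_biUnion_le_card_mul Finset.univ f L fun y _ => hf y
  obtain ⟨B, hB, hdisj, hgain⟩ := exists_disjoint_topSum_sub_le (Q := Q) hunion j
  have hdisj_f (y : 𝒴) : Disjoint (f y) B :=
    Finset.disjoint_of_subset_left (Finset.subset_biUnion_of_mem f (Finset.mem_univ y)) hdisj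
  have hcard (y : 𝒴) : (f y ∪ B).card ≤ L + j := by
    rw [Finset.card_union_of_disjoint (hdisj_f y), hB]
    exact Nat.add_le_add_right (hf y) j
  calc ∑ y, w y * ∑ x ∈ f y, (p y x).toReal +
        (topSum Q (Fintype.card 𝒴 * L + j) - topSum Q (Fintype.card 𝒴 * L))
      ≤ ∑ y, w y * ∑ x ∈ f y, (p y x).toReal + ∑ x ∈ B, (Q x).toReal := add_le_add le_rfl hgain
    _ = ∑ y, w y * ∑ x ∈ f y ∪ B, (p y x).toReal := by
        simp only [Finset.sum_union (hdisj_f _), mul_add, Finset.sum_add_distrib, h.sum_eq]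
    _ ≤ ∑ y, w y * topSum (p y) (L + j) := h.sum_list_le hcard

theorem fanoType2_isMajorizedBy_avgDecr (h : IsMixture w p Q) {L : ℕ} {ε : ℝ} (hL : 1 ≤ L)
    (hsys : Admissible Q L ε (Fintype.card 𝒴))
    (herr : ∀ δ > 0, ∃ f : 𝒴 → Finset ℕ+, (∀ y, (f y).card ≤ L) ∧
      1 - ε - δ ≤ ∑ y, w y * ∑ x ∈ f y, (p y x).toReal) :
    IsMajorizedBy (fanoType2 Q L ε (Fintype.card 𝒴)) (avgDecr w p) := by
  refine fanoType2_isMajorizedBy hL hsys (fun k => ?_) fun j => ?_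
  · obtain ⟨T, hT, hsum⟩ := exists_sum_avgDecr_eq w p k
    exact ⟨T, hT, (h.topSum_le k).trans_eq hsum.symm⟩
  · obtain ⟨T, hT, hsum⟩ := exists_sum_avgDecr_eq w p (L + j)
    refine ⟨T, hT, le_of_forall_pos_le_add fun δ hδ => ?_⟩
    obtain ⟨f, hf, hle⟩ := herr δ hδ
    have := h.sum_list_add_topSum_sub_le hf j
    linarith

theorem sum_tsum_ofReal_decr_le (h : IsMixture w p Q) {G : ℝ → ℝ}
    (hG : ConcaveOn ℝ (Set.Icc 0 1) G) (hG0 : ∀ t ∈ Set.Icc (0 : ℝ) 1, 0 ≤ G t) :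
    ∑ y, ENNReal.ofReal (w y) * ∑' x : ℕ+, ENNReal.ofReal (G (decr (p y) x)) ≤
      ∑' x, ENNReal.ofReal (G (avgDecr w p x)) :=
  sum_tsum_ofReal_le_of_concaveOn h.nonneg h.sum_eq_one hG hG0 fun y x =>
    ⟨decr_nonneg _ _, le_one_of_hasSum (fun _ => decr_nonneg _ _) (hasSum_decr (p y)) x⟩

theorem tsum_ofReal_avgDecr_le (h : IsMixture w p Q) {G : ℝ → ℝ}
    (hG : ConvexOn ℝ (Set.Ici 0) G) (hG0 : ∀ t ∈ Set.Ici (0 : ℝ), 0 ≤ G t) :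
    ∑' x, ENNReal.ofReal (G (avgDecr w p x)) ≤
      ∑ y, ENNReal.ofReal (w y) * ∑' x : ℕ+, ENNReal.ofReal (G (decr (p y) x)) :=
  tsum_ofReal_le_of_convexOn h.nonneg h.sum_eq_one hG hG0 fun _ _ => decr_nonneg _ _

end IsMixture

theorem ofReal_mul_lNorm {α : ℝ} (hα : 0 < α) {c : ℝ} (hc : 0 ≤ c) (P : ℕ+ → ℝ) :
    ENNReal.ofReal c * lNorm α P = (∑' x, ENNReal.ofReal (c * P x) ^ α) ^ (1 / α) := by
  simp only [ENNReal.ofReal_mul hc, ENNReal.mul_rpow_of_nonneg _ _ hα.le, ENNReal.tsum_mul_left,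
    ENNReal.mul_rpow_of_nonneg _ _ (one_div_pos.2 hα).le, ← ENNReal.rpow_mul,
    mul_one_div_cancel hα.ne', ENNReal.rpow_one, lNorm]

namespace IsMixture

theorem ofReal_avgDecr (h : IsMixture w p Q) (x : ℕ+) :
    ENNReal.ofReal (avgDecr w p x) = ∑' y, ENNReal.ofReal (w y * decr (p y) x) := by
  rw [tsum_fintype]
  exact ENNReal.ofReal_sum_of_nonneg fun y _ => mul_nonneg (h.nonneg y) (decr_nonneg _ _)

theorem sum_lNorm_decr_eq (h : IsMixture w p Q) {α : ℝ} (hα : 0 < α) :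
    ∑ y, ENNReal.ofReal (w y) * lNorm α (fun x => decr (p y) x) =
      ∑' y, (∑' x : ℕ+, ENNReal.ofReal (w y * decr (p y) x) ^ α) ^ (1 / α) := by
  rw [tsum_fintype]
  exact Finset.sum_congr rfl fun y _ => ofReal_mul_lNorm hα (h.nonneg y) _

theorem lNorm_avgDecr_le (h : IsMixture w p Q) {α : ℝ} (hα : 1 ≤ α) :
    lNorm α (avgDecr w p) ≤ ∑ y, ENNReal.ofReal (w y) * lNorm α (fun x => decr (p y) x) := by
  rw [h.sum_lNorm_decr_eq (zero_lt_one.trans_le hα), lNorm]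
  simp only [h.ofReal_avgDecr]
  exact Lp_tsum_tsum_le hα _

theorem le_lNorm_avgDecr (h : IsMixture w p Q) {α : ℝ} (hα0 : 0 < α) (hα : α ≤ 1) :
    ∑ y, ENNReal.ofReal (w y) * lNorm α (fun x => decr (p y) x) ≤ lNorm α (avgDecr w p) := by
  rw [h.sum_lNorm_decr_eq hα0, lNorm]
  simp only [h.ofReal_avgDecr]
  exact tsum_Lp_le_Lp_tsum hα0 hα _

end IsMixture

end Mixture

section ConditionalLaw

variable {Ω 𝒴 : Type*} [MeasurableSpace Ω] [MeasurableSpace 𝒴]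

/-- The conditional distribution of `X` given `Y = y`, as a `PMF`. For `y` outside the support of
`Y` it is an arbitrary distribution, which enters all averages with weight `0`. -/
noncomputable def condPMF (μ : Measure Ω) [IsProbabilityMeasure μ] (X : Ω → ℕ+) (Y : Ω → 𝒴)
    (y : 𝒴) : PMF ℕ+ :=
  (condDistrib X Y μ y).toPMF

variable {μ : Measure Ω} [IsProbabilityMeasure μ] {X : Ω → ℕ+} {Y : Ω → 𝒴}

theorem toReal_condPMF (y : 𝒴) (x : ℕ+) :
    (condPMF μ X Y y x).toReal = (condDistrib X Y μ y).real {x} := by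
  rw [condPMF, Measure.toPMF_apply, Measure.real]

theorem tsum_comp_condLaw (Φ : ℝ → ℝ≥0∞) (hΦ : Φ 0 = 0) (ω : Ω) :
    ∑' x, Φ (condLaw μ X Y ω x) = ∑' x : ℕ+, Φ (decr (condPMF μ X Y (Y ω)) x) := by
  simp only [tsum_comp_decr _ Φ hΦ, toReal_condPMF, condLaw]

theorem tsum_rpow_condLaw {α : ℝ} (hα : 0 < α) (ω : Ω) :
    ∑' x, ENNReal.ofReal (condLaw μ X Y ω x) ^ α =
      ∑' x : ℕ+, ENNReal.ofReal (decr (condPMF μ X Y (Y ω)) x) ^ α :=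
  tsum_comp_condLaw (fun t => ENNReal.ofReal t ^ α) (by simp [hα]) ω

variable [Fintype 𝒴] [DiscreteMeasurableSpace 𝒴]

theorem lintegral_comp_eq_sum (hY : Measurable Y) (F : 𝒴 → ℝ≥0∞) :
    ∫⁻ ω, F (Y ω) ∂μ = ∑ y, ENNReal.ofReal ((μ.map Y).real {y}) * F y := by
  have := Measure.isProbabilityMeasure_map (μ := μ) hY.aemeasurable
  rw [← lintegral_map (f := F) Measurable.of_discrete hY, lintegral_fintype]
  exact Finset.sum_congr rfl fun y _ => by rw [mul_comm, ofReal_measureReal]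

theorem condShannon_eq (hY : Measurable Y) :
    condShannon μ X Y = ∑ y, ENNReal.ofReal ((μ.map Y).real {y}) *
      ∑' x : ℕ+, ENNReal.ofReal (Real.negMulLog (decr (condPMF μ X Y y) x)) := by
  rw [condShannon, ← lintegral_comp_eq_sum hY]
  exact lintegral_congr fun ω =>
    tsum_comp_condLaw (fun t => ENNReal.ofReal (Real.negMulLog t)) (by simp) ω

theorem lintegral_lNorm_eq (hY : Measurable Y) {α : ℝ} (hα : 0 < α) :
    ∫⁻ ω, lNorm α (condLaw μ X Y ω) ∂μ = ∑ y, ENNReal.ofReal ((μ.map Y).real {y}) *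
      lNorm α (fun x : ℕ+ => decr (condPMF μ X Y y) x) := by
  rw [← lintegral_comp_eq_sum hY]
  simp only [lNorm, tsum_rpow_condLaw hα]

theorem lintegral_lNorm_rpow_eq (hY : Measurable Y) {α : ℝ} (hα : 0 < α) :
    ∫⁻ ω, lNorm α (condLaw μ X Y ω) ^ α ∂μ = ∑ y, ENNReal.ofReal ((μ.map Y).real {y}) *
      ∑' x : ℕ+, ENNReal.ofReal (decr (condPMF μ X Y y) x) ^ α := by
  rw [← lintegral_comp_eq_sum hY]
  simp only [lNorm, ← ENNReal.rpow_mul, one_div_mul_cancel hα.ne', ENNReal.rpow_one,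
    tsum_rpow_condLaw hα]

theorem measureReal_mem_list (hX : Measurable X) (hY : Measurable Y) (f : 𝒴 → Finset ℕ+) :
    μ.real {ω | X ω ∈ f (Y ω)} =
      ∑ y, (μ.map Y).real {y} * ∑ x ∈ f y, (condPMF μ X Y y x).toReal := by
  have := Measure.isProbabilityMeasure_map (μ := μ) hY.aemeasurable
  have hS : MeasurableSet {z : 𝒴 × ℕ+ | z.2 ∈ f z.1} := .of_discrete
  have hμ : μ {ω | X ω ∈ f (Y ω)} = ∑ y, condDistrib X Y μ y (f y) * (μ.map Y) {y} :=
    calc μ {ω | X ω ∈ f (Y ω)}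
        = μ.map (fun ω => (Y ω, X ω)) {z : 𝒴 × ℕ+ | z.2 ∈ f z.1} :=
          (Measure.map_apply (hY.prodMk hX) hS).symm
      _ = ∫⁻ y, condDistrib X Y μ y (f y) ∂μ.map Y := by
          rw [← compProd_map_condDistrib hX.aemeasurable, Measure.compProd_apply hS]
          rfl
      _ = _ := lintegral_fintype _
  rw [Measure.real, hμ, ENNReal.toReal_sum fun y _ =>
    ENNReal.mul_ne_top (measure_ne_top _ _) (measure_ne_top _ _)]
  refine Finset.sum_congr rfl fun y _ => ?_
  rw [ENNReal.toReal_mul, mul_comm]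
  simp only [toReal_condPMF, sum_measureReal_singleton]
  rfl

variable {Q : PMF ℕ+} {L : ℕ} {ε : ℝ}

theorem isMixture_condPMF (hX : Measurable X) (hY : Measurable Y) (hQ : μ.map X = Q.toMeasure) :
    IsMixture (fun y => (μ.map Y).real {y}) (condPMF μ X Y) Q where
  nonneg _ := measureReal_nonneg
  sum_eq_one := by
    have := Measure.isProbabilityMeasure_map (μ := μ) hY.aemeasurable
    rw [sum_measureReal_singleton, Finset.coe_univ, probReal_univ]
  mass_eq x := by
    have hmem := measureReal_mem_list (μ := μ) hX hY fun _ => {x}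
    simp only [Finset.mem_singleton, Finset.sum_singleton] at hmem
    rw [← hmem, ← Q.toMeasure_apply_singleton x (measurableSet_singleton x), ← hQ,
      Measure.map_apply hX (measurableSet_singleton x)]
    rfl

end ConditionalLaw

section ConditionalEntropy

variable {Ω 𝒴 : Type*} [MeasurableSpace Ω] [MeasurableSpace 𝒴] [Fintype 𝒴]
  [DiscreteMeasurableSpace 𝒴] {μ : Measure Ω} [IsProbabilityMeasure μ] {X : Ω → ℕ+} {Y : Ω → 𝒴}

variable {Q : PMF ℕ+} (hY : Measurable Y)
  (h : IsMixture (fun y => (μ.map Y).real {y}) (condPMF μ X Y) Q)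
include hY h

theorem condShannon_le_avgDecr :
    condShannon μ X Y ≤
      shannonEntropy (avgDecr (fun y => (μ.map Y).real {y}) (condPMF μ X Y)) := by
  rw [condShannon_eq hY]
  exact h.sum_tsum_ofReal_decr_le
    (Real.concaveOn_negMulLog.subset Set.Icc_subset_Ici_self (convex_Icc 0 1))
    fun t ht => Real.negMulLog_nonneg ht.1 ht.2

theorem arimoto_le_avgDecr {α : ℝ} (hα : 0 < α) :
    arimoto α μ X Y ≤
      renyiEntropy α (avgDecr (fun y => (μ.map Y).real {y}) (condPMF μ X Y)) := by
  by_cases hα1 : α = 1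
  · rw [arimoto, renyiEntropy, if_pos hα1, if_pos hα1, EReal.coe_ennreal_le_coe_ennreal_iff]
    exact condShannon_le_avgDecr hY h
  rw [arimoto, if_neg hα1, renyiEntropy_eq_log_lNorm hα hα1, lintegral_lNorm_eq hY hα]
  rcases lt_or_gt_of_ne hα1 with hlt | hgt
  · exact mul_log_le_mul_log_of_nonneg (div_nonneg hα.le (by linarith))
      (h.le_lNorm_avgDecr hα hlt.le)
  · exact mul_log_le_mul_log_of_nonpos (div_nonpos_of_nonneg_of_nonpos hα.le (by linarith))
      (h.lNorm_avgDecr_le hgt.le)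

theorem hayashi_le_avgDecr {α : ℝ} (hα : 0 < α) :
    hayashi α μ X Y ≤
      renyiEntropy α (avgDecr (fun y => (μ.map Y).real {y}) (condPMF μ X Y)) := by
  by_cases hα1 : α = 1
  · rw [hayashi, renyiEntropy, if_pos hα1, if_pos hα1, EReal.coe_ennreal_le_coe_ennreal_iff]
    exact condShannon_le_avgDecr hY h
  have hdecr (y : 𝒴) := tsum_ofReal_rpow hα.le fun x : ℕ+ => decr_nonneg (condPMF μ X Y y) x
  rw [hayashi, renyiEntropy, if_neg hα1, if_neg hα1, lintegral_lNorm_rpow_eq hY hα,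
    tsum_ofReal_rpow hα.le h.avgDecr_nonneg]
  simp only [hdecr]
  rcases lt_or_gt_of_ne hα1 with hlt | hgt
  · exact mul_log_le_mul_log_of_nonneg (div_nonneg zero_le_one (by linarith)) <|
      h.sum_tsum_ofReal_decr_le ((Real.concaveOn_rpow hα.le hlt.le).subset
        Set.Icc_subset_Ici_self (convex_Icc 0 1)) fun t ht => Real.rpow_nonneg ht.1 α
  · exact mul_log_le_mul_log_of_nonpos
      (div_nonpos_of_nonneg_of_nonpos zero_le_one (by linarith)) <|
      h.tsum_ofReal_avgDecr_le (convexOn_rpow hgt.le) fun t ht => Real.rpow_nonneg ht α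

end ConditionalEntropy

namespace Feasible

variable {Ω 𝒴 : Type*} [MeasurableSpace Ω] [MeasurableSpace 𝒴] [Fintype 𝒴]
  [DiscreteMeasurableSpace 𝒴] {μ : Measure Ω} [IsProbabilityMeasure μ] {X : Ω → ℕ+} {Y : Ω → 𝒴}
  {Q : PMF ℕ+} {L : ℕ} {ε : ℝ}

theorem isMixture (h : Feasible Q L ε μ X Y) :
    IsMixture (fun y => (μ.map Y).real {y}) (condPMF μ X Y) Q :=
  isMixture_condPMF h.measurable_X h.measurable_Y h.law_X

theorem exists_list (h : Feasible Q L ε μ X Y) (hL : 1 ≤ L) {δ : ℝ} (hδ : 0 < δ) :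
    ∃ f : 𝒴 → Finset ℕ+, (∀ y, (f y).card ≤ L) ∧
      1 - ε - δ ≤ ∑ y, (μ.map Y).real {y} * ∑ x ∈ f y, (condPMF μ X Y y x).toReal := by
  have hne : Nonempty {f : 𝒴 → Finset ℕ+ // ∀ y, 1 ≤ (f y).card ∧ (f y).card ≤ L} :=
    ⟨⟨fun _ => {1}, fun _ => by simp [hL]⟩⟩
  have hlt : listError L μ X Y < ε + δ := h.error_le.trans_lt (lt_add_of_pos_right ε hδ)
  obtain ⟨⟨f, hf⟩, hlt⟩ := exists_lt_of_ciInf_lt hlt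
  refine ⟨f, fun y => (hf y).2, ?_⟩
  have hmeas : MeasurableSet {ω | X ω ∈ f (Y ω)} :=
    (h.measurable_Y.prodMk h.measurable_X) (.of_discrete (s := {z : 𝒴 × ℕ+ | z.2 ∈ f z.1}))
  have hcompl : μ.real {ω | X ω ∉ f (Y ω)} = 1 - μ.real {ω | X ω ∈ f (Y ω)} :=
    probReal_compl_eq_one_sub hmeas
  rw [← measureReal_mem_list h.measurable_X h.measurable_Y]
  linarith

variable (h : Feasible Q L ε μ X Y) (hL : 1 ≤ L) (hsys : Admissible Q L ε (Fintype.card 𝒴))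
include h hL hsys

theorem fanoType2_isMajorizedBy :
    IsMajorizedBy (fanoType2 Q L ε (Fintype.card 𝒴))
      (avgDecr (fun y => (μ.map Y).real {y}) (condPMF μ X Y)) :=
  h.isMixture.fanoType2_isMajorizedBy_avgDecr hL hsys fun _ hδ => h.exists_list hL hδ

theorem condShannon_le :
    condShannon μ X Y ≤ shannonEntropy (fanoType2 Q L ε (Fintype.card 𝒴)) :=
  (condShannon_le_avgDecr h.measurable_Y h.isMixture).trans <|
    (h.fanoType2_isMajorizedBy hL hsys).shannonEntropy_le h.isMixture.avgDecr_nonneg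
      h.isMixture.hasSum_avgDecr (fanoType2_nonneg hL hsys) (hasSum_fanoType2 hL hsys)

theorem renyiEntropy_avgDecr_le {α : ℝ} (hα : 0 < α) :
    renyiEntropy α (avgDecr (fun y => (μ.map Y).real {y}) (condPMF μ X Y)) ≤
      renyiEntropy α (fanoType2 Q L ε (Fintype.card 𝒴)) :=
  (h.fanoType2_isMajorizedBy hL hsys).renyiEntropy_le h.isMixture.avgDecr_nonneg
    h.isMixture.hasSum_avgDecr (fanoType2_nonneg hL hsys) (hasSum_fanoType2 hL hsys) hα

theorem arimoto_le {α : ℝ} (hα : 0 < α) :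
    arimoto α μ X Y ≤ renyiEntropy α (fanoType2 Q L ε (Fintype.card 𝒴)) :=
  (arimoto_le_avgDecr h.measurable_Y h.isMixture hα).trans (h.renyiEntropy_avgDecr_le hL hsys hα)

theorem hayashi_le {α : ℝ} (hα : 0 < α) :
    hayashi α μ X Y ≤ renyiEntropy α (fanoType2 Q L ε (Fintype.card 𝒴)) :=
  (hayashi_le_avgDecr h.measurable_Y h.isMixture hα).trans (h.renyiEntropy_avgDecr_le hL hsys hα)

end Feasible

section Value

variable {Q : PMF ℕ+} {L : ℕ} {ε : ℝ} {m : ℕ}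

theorem tsum_pnat_subtype_eq (h : ℕ+ → ℝ≥0∞) {a b : ℕ} (hab : a ≤ b + 1) :
    ∑' x : {x : ℕ+ // (x : ℕ) < a ∨ b < (x : ℕ)}, h x =
      ∑ n ∈ Finset.range (a - 1), h n.succPNat + ∑' n, h (b + n).succPNat := by
  have hmem (n : ℕ) : n.succPNat ∈ {x : ℕ+ | (x : ℕ) < a ∨ b < (x : ℕ)} ↔ n < a - 1 ∨ b ≤ n := by
    rw [Set.mem_ofPred_eq, Nat.succPNat_coe]
    omega
  refine (tsum_subtype {x : ℕ+ | (x : ℕ) < a ∨ b < (x : ℕ)} h).trans ?_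
  rw [tsum_pnat_eq_sum_range_add _ b]
  congr 1
  · rw [← Finset.sum_subset (Finset.range_mono (by omega : a - 1 ≤ b)) fun n hn hn' => ?_]
    · exact Finset.sum_congr rfl fun n hn =>
        Set.indicator_of_mem ((hmem n).2 (.inl (Finset.mem_range.1 hn))) h
    · rw [Finset.mem_range] at hn hn'
      exact Set.indicator_of_notMem (by rw [hmem]; omega) h
  · exact tsum_congr fun n =>
      Set.indicator_of_mem ((hmem _).2 (.inr (Nat.le_add_right b n))) h

theorem V_J_mem_Icc (hL : 1 ≤ L) (h : Admissible Q L ε m) :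
    V Q L ε (J Q L ε) ∈ Set.Icc (0 : ℝ) 1 :=
  ⟨V_J_nonneg hL, V_J_le_one hL h⟩

theorem W_K₂_mem_Icc (hL : 1 ≤ L) (h : Admissible Q L ε m) (hK : L < K₂ Q L ε m) :
    W Q L ε (K₂ Q L ε m) ∈ Set.Icc (0 : ℝ) 1 :=
  ⟨W_K₂_nonneg hL h hK, (W_K₂_le_V_J hL h hK).trans (V_J_le_one hL h)⟩

theorem tsum_ofReal_fanoType2 (hL : 1 ≤ L) (h : Admissible Q L ε m) {G : ℝ → ℝ}
    (hG : ∀ t ∈ Set.Icc (0 : ℝ) 1, 0 ≤ G t) :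
    ∑' x, ENNReal.ofReal (G (fanoType2 Q L ε m x)) =
      ENNReal.ofReal (((L : ℝ) - (J Q L ε : ℝ) + 1) * G (V Q L ε (J Q L ε))
        + ((K₂ Q L ε m : ℝ) - (L : ℝ)) * G (W Q L ε (K₂ Q L ε m)))
      + ∑' x : {x : ℕ+ // (x : ℕ) < J Q L ε ∨ K₂ Q L ε m < (x : ℕ)},
          ENNReal.ofReal (G (decr Q x.1)) := by
  have hJ : J Q L ε ≤ L + 1 := J_le_succ hL
  have hK : L ≤ K₂ Q L ε m := le_K₂ hL h
  have hV : 0 ≤ (L + 1 - J Q L ε) • G (V Q L ε (J Q L ε)) :=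
    nsmul_nonneg (hG _ (V_J_mem_Icc hL h)) _
  have hW : 0 ≤ (K₂ Q L ε m - L) • G (W Q L ε (K₂ Q L ε m)) := by
    rcases hK.eq_or_lt with heq | hlt
    · rw [← heq, Nat.sub_self, zero_smul]
    · exact nsmul_nonneg (hG _ (W_K₂_mem_Icc hL h hlt)) _
  have hplateaus : ((L : ℝ) - (J Q L ε : ℝ) + 1) * G (V Q L ε (J Q L ε))
        + ((K₂ Q L ε m : ℝ) - (L : ℝ)) * G (W Q L ε (K₂ Q L ε m)) =
      (L + 1 - J Q L ε) • G (V Q L ε (J Q L ε)) +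
        (K₂ Q L ε m - L) • G (W Q L ε (K₂ Q L ε m)) := by
    rw [nsmul_eq_mul, nsmul_eq_mul, Nat.cast_sub hJ, Nat.cast_sub hK]
    push_cast
    ring
  rw [tsum_comp_fanoType2 hL h fun t => ENNReal.ofReal (G t), hplateaus, ENNReal.ofReal_add hV hW,
    ENNReal.ofReal_nsmul, ENNReal.ofReal_nsmul,
    tsum_pnat_subtype_eq (fun x => ENNReal.ofReal (G (decr Q x))) (by omega)]
  simp only [Nat.succPNat_coe, Nat.succ_eq_add_one]
  ac_rfl

theorem renyiEntropy_fanoType2 (hL : 1 ≤ L) (h : Admissible Q L ε m) {α : ℝ} (hα : 0 ≤ α)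
    (hα1 : α ≠ 1) :
    renyiEntropy α (fanoType2 Q L ε m) =
      ((1 / (1 - α) : ℝ) : EReal) * ENNReal.log
        (ENNReal.ofReal (((L : ℝ) - (J Q L ε : ℝ) + 1) * V Q L ε (J Q L ε) ^ α
            + ((K₂ Q L ε m : ℝ) - (L : ℝ)) * W Q L ε (K₂ Q L ε m) ^ α)
          + ∑' x : {x : ℕ+ // (x : ℕ) < J Q L ε ∨ K₂ Q L ε m < (x : ℕ)},
              ENNReal.ofReal (decr Q x.1 ^ α)) := by
  rw [renyiEntropy, if_neg hα1, tsum_ofReal_rpow hα (fanoType2_nonneg hL h),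
    tsum_ofReal_fanoType2 hL h (G := (· ^ α)) fun t ht => Real.rpow_nonneg ht.1 α]

theorem shannonEntropy_fanoType2 (hL : 1 ≤ L) (h : Admissible Q L ε m) :
    shannonEntropy (fanoType2 Q L ε m) =
      ENNReal.ofReal (((L : ℝ) - (J Q L ε : ℝ) + 1) * Real.negMulLog (V Q L ε (J Q L ε))
        + ((K₂ Q L ε m : ℝ) - (L : ℝ)) * Real.negMulLog (W Q L ε (K₂ Q L ε m)))
      + ∑' x : {x : ℕ+ // (x : ℕ) < J Q L ε ∨ K₂ Q L ε m < (x : ℕ)},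
          ENNReal.ofReal (Real.negMulLog (decr Q x.1)) :=
  tsum_ofReal_fanoType2 hL h fun _ ht => Real.negMulLog_nonneg ht.1 ht.2

/-- For `L = 1` the first symbol carries mass `1 - ε` whether `J = 1` or `J = 2`. -/
theorem shannonEntropy_fanoType2_one (h : Admissible Q 1 ε m) :
    shannonEntropy (fanoType2 Q 1 ε m) =
      ENNReal.ofReal (Real.negMulLog (1 - ε)
        + ((K₂ Q 1 ε m : ℝ) - 1) * Real.negMulLog (W Q 1 ε (K₂ Q 1 ε m)))
      + ∑' x : {x : ℕ+ // K₂ Q 1 ε m < (x : ℕ)},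
          ENNReal.ofReal (Real.negMulLog (decr Q x.1)) := by
  have htail : ∑' x : {x : ℕ+ // (x : ℕ) < 1 ∨ K₂ Q 1 ε m < (x : ℕ)},
      ENNReal.ofReal (Real.negMulLog (decr Q x.1)) =
        ∑' x : {x : ℕ+ // K₂ Q 1 ε m < (x : ℕ)}, ENNReal.ofReal (Real.negMulLog (decr Q x.1)) :=
    tsum_congr_set_coe (fun x : ℕ+ => ENNReal.ofReal (Real.negMulLog (decr Q x)))
      (Set.ext fun x => or_iff_right (not_lt.2 x.pos))
  have hJ : J Q 1 ε = 1 ∨ J Q 1 ε = 2 := by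
    have := one_le_J (Q := Q) (ε := ε) le_rfl
    have := J_le_succ (Q := Q) (ε := ε) le_rfl
    omega
  rcases hJ with hJ | hJ
  · have hV : V Q 1 ε 1 = 1 - ε := by simp [V, topSum_zero]
    rw [shannonEntropy_fanoType2 le_rfl h, hJ, hV, htail]
    simp
  · have hlt : ¬topSum Q 1 < 1 - ε := (J_le_iff le_rfl).not.1 (by omega)
    have hK : K₂ Q 1 ε m = 1 := le_antisymm (not_lt.1 ((lt_K₂_iff le_rfl h).not.2 hlt))
      (le_K₂ le_rfl h)
    have hdecr : decr Q 1 = 1 - ε := by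
      rw [← h.topSum_le.antisymm (not_lt.1 hlt), topSum_succ, topSum_zero, zero_add]
    have hsplit {a : ℕ} := tsum_pnat_subtype_eq (a := a) (b := 1)
      fun x => ENNReal.ofReal (Real.negMulLog (decr Q x))
    rw [shannonEntropy_fanoType2 le_rfl h, ← htail, hJ, hK, hsplit le_rfl, hsplit one_le_two]
    norm_num [hdecr]

end Value

end FanoRenyi

theorem corollary2 (𝒴 : Type v) [Fintype 𝒴] [MeasurableSpace 𝒴] [DiscreteMeasurableSpace 𝒴]
    (Q : PMF ℕ+) (L : ℕ) (hL : 1 ≤ L) (ε : ℝ) (m : ℕ) (hm : m = Fintype.card 𝒴)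
    (hsys : Admissible Q L ε m) :
    -- the Fano-distribution of type 2 is a probability distribution
    ((∀ x, 0 ≤ fanoType2 Q L ε m x) ∧ HasSum (fanoType2 Q L ε m) 1) ∧
    -- the upper bounds
    (∀ α : ℝ, 0 < α →
      supArimoto.{u, v} α Q L ε 𝒴 ≤ renyiEntropy α (fanoType2 Q L ε m) ∧
      supHayashi.{u, v} α Q L ε 𝒴 ≤ renyiEntropy α (fanoType2 Q L ε m)) ∧
    -- the explicit value for `α ≠ 1`
    (∀ α : ℝ, 0 < α → α ≠ 1 →
      renyiEntropy α (fanoType2 Q L ε m) =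
        ((1 / (1 - α) : ℝ) : EReal) * ENNReal.log
          (ENNReal.ofReal (((L : ℝ) - (J Q L ε : ℝ) + 1) * V Q L ε (J Q L ε) ^ α
              + ((K₂ Q L ε m : ℝ) - (L : ℝ)) * W Q L ε (K₂ Q L ε m) ^ α)
            + ∑' x : {x : ℕ+ // (x : ℕ) < J Q L ε ∨ K₂ Q L ε m < (x : ℕ)},
                ENNReal.ofReal (decr Q x.1 ^ α))) ∧
    -- the explicit value for `α = 1`
    (renyiEntropy 1 (fanoType2 Q L ε m) =
      ((ENNReal.ofReal (((L : ℝ) - (J Q L ε : ℝ) + 1) * Real.negMulLog (V Q L ε (J Q L ε))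
          + ((K₂ Q L ε m : ℝ) - (L : ℝ)) * Real.negMulLog (W Q L ε (K₂ Q L ε m)))
        + ∑' x : {x : ℕ+ // (x : ℕ) < J Q L ε ∨ K₂ Q L ε m < (x : ℕ)},
            ENNReal.ofReal (Real.negMulLog (decr Q x.1)) : ℝ≥0∞) : EReal)) ∧
    -- the case `α = 1`, `L = 1`
    (L = 1 →
      supShannon.{u, v} Q 1 ε 𝒴 ≤
        ENNReal.ofReal (Real.negMulLog (1 - ε)
          + ((K₂ Q 1 ε m : ℝ) - 1) * Real.negMulLog (W Q 1 ε (K₂ Q 1 ε m)))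
        + ∑' x : {x : ℕ+ // K₂ Q 1 ε m < (x : ℕ)},
            ENNReal.ofReal (Real.negMulLog (decr Q x.1))) := by
  subst hm
  refine ⟨⟨fanoType2_nonneg hL hsys, hasSum_fanoType2 hL hsys⟩,
    fun α hα => ⟨sSup_le ?_, sSup_le ?_⟩,
    fun α hα hα1 => renyiEntropy_fanoType2 hL hsys hα.le hα1, ?_, ?_⟩
  · rintro _ ⟨Ω, _, μ, _, X, Y, h, rfl⟩
    exact h.arimoto_le hL hsys hα
  · rintro _ ⟨Ω, _, μ, _, X, Y, h, rfl⟩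
    exact h.hayashi_le hL hsys hα
  · rw [renyiEntropy, if_pos rfl, shannonEntropy_fanoType2 hL hsys]
  · rintro rfl
    rw [← shannonEntropy_fanoType2_one hsys]
    refine sSup_le ?_
    rintro _ ⟨Ω, _, μ, _, X, Y, h, rfl⟩
    exact h.condShannon_le hL hsys
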